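/- The brushing game on a finite simple graph $G$ is played by two players, Min and Max. Initially every vertex is dirty and there are no brushes. A dirty vertex that holds at least as many brushes as it has dirty neighbours fires: it sends one brush to each dirty neighbour and becomes clean. Vertices fire one after another until no dirty vertex is ready to fire (the order does not affect which vertices become clean or the number of brushes on the dirty vertices). This is done at the start and after each turn. The players alternate turns; on each turn a player adds one brush to a dirty vertex of his or her choice. The game ends when all vertices are clean. Min wants to minimize and Max to maximize the number of turns. The game brush number $b_g(G)$ is the number of turns when Min plays first and both play optimally. Let $\mathcal G(n,p)$ be the binomial random graph on $n$ labelled vertices, in which each pair of vertices is an edge independently with probability $p$. **Theorem.** Let $p=p(n)\in[0,1]$ satisfy $p\gg \ln n/n$, that is, $(\ln n/n)/p(n)\to 0$ as $n\to\infty$, and let $G\in\mathcal G(n,p)$. Then asymptotically almost surely $$b_g(G)=(1+o(1))\,p\,b_g(K_n)=(1+o(1))\,\frac{p\,n^2}{e}.$$ That is, $p\,b_g(K_n)=(1+o(1))\,pn^2/e$ as $n\to\infty$, and for every $\varepsilon>0$, as $n\to\infty$, $$\Pr\bigl(|b_g(G)-p\,b_g(K_n)|\le\varepsilon\,p\,b_g(K_n)\bigr)\to1\quad\text{and}\quad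 \Pr\bigl(|b_g(G)-pn^2/e|\le\varepsilon\, pn^2/e\bigr)\to1.$$ -/

import Mathlib

namespace Brushing

/-- A position of the brushing process: the vertices that are still dirty, and the number of
brushes lying on each vertex. An edge is dirty exactly when both of its endpoints are dirty. -/
structure State (V : Type*) where
  dirty : Finset V
  brushes : V → ℕ

/-- The player whose turn it is. -/
inductive Player
  | min
  | max

section

variable {V : Type*} [DecidableEq V] (G : SimpleGraph V)

open Classical in
/-- The dirty neighbours of `v`. -/
noncomputable def dirtyNbrs (s : State V) (v : V) : Finset V :=
  {w ∈ s.dirty | G.Adj v w}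

/-- A dirty vertex is ready to fire when it holds at least as many brushes as it has dirty
neighbours. -/
def Ready (s : State V) (v : V) : Prop :=
  v ∈ s.dirty ∧ (dirtyNbrs G s v).card ≤ s.brushes v

/-- Firing `v`: it sends one brush to each dirty neighbour and becomes clean; excess brushes stay
on `v`. -/
noncomputable def fire (s : State V) (v : V) : State V where
  dirty := s.dirty.erase v
  brushes w :=
    if w = v then s.brushes v - (dirtyNbrs G s v).card
    else if w ∈ dirtyNbrs G s v then s.brushes w + 1
    else s.brushes w

open Classical in
/-- Fire ready vertices one at a time until no vertex is ready. The order is irrelevant, see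
`stabilize_unique`. -/
noncomputable def stabilize (s : State V) : State V :=
  if h : ∃ v, Ready G s v then stabilize (fire G s h.choose) else s
termination_by s.dirty.card
decreasing_by exact Finset.card_erase_lt_of_mem h.choose_spec.1

/-- Add one brush to `v`, without firing anything yet. -/
def addBrush (s : State V) (v : V) : State V where
  dirty := s.dirty
  brushes := Function.update s.brushes v (s.brushes v + 1)

/-- One turn: a brush is added to `v`, then vertices fire until the configuration is stable. -/
noncomputable def turn (s : State V) (v : V) : State V :=
  stabilize G (addBrush s v)

/-- `t` arises from `s` by firing some list of vertices, each of them ready when it fires. -/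
def Reaches (s t : State V) : Prop :=
  Relation.ReflTransGen (fun a b => ∃ v, Ready G a v ∧ b = fire G a v) s t

theorem reaches_stabilize (s : State V) :
    Reaches G s (stabilize G s) ∧ ∀ v, ¬ Ready G (stabilize G s) v := by
  induction hn : s.dirty.card using Nat.strong_induction_on generalizing s with
  | _ n ih =>
    rw [stabilize]
    split_ifs with h
    · have hlt : (fire G s h.choose).dirty.card < n :=
        hn ▸ Finset.card_erase_lt_of_mem h.choose_spec.1
      obtain ⟨h1, h2⟩ := ih _ hlt _ rfl
      exact ⟨Relation.ReflTransGen.head ⟨_, h.choose_spec, rfl⟩ h1, h2⟩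
    · exact ⟨Relation.ReflTransGen.refl, fun v hv => h ⟨v, hv⟩⟩

theorem reaches_invariant {s t : State V} (h : Reaches G s t) :
    t.dirty ⊆ s.dirty ∧ ∀ v ∈ t.dirty,
      t.brushes v + (dirtyNbrs G t v).card = s.brushes v + (dirtyNbrs G s v).card := by
  classical
  induction h with
  | refl => exact ⟨subset_rfl, fun _ _ => rfl⟩
  | @tail b c _ hbc ih =>
    obtain ⟨v, hv, rfl⟩ := hbc
    refine ⟨(Finset.erase_subset _ _).trans ih.1, fun w hw => ?_⟩
    have hw' : w ≠ v ∧ w ∈ b.dirty := by simpa [fire] using hw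
    rw [← ih.2 w hw'.2]
    have he : dirtyNbrs G (fire G b v) w = (dirtyNbrs G b w).erase v := by
      ext x; simp [dirtyNbrs, fire, and_assoc]
    rw [he]
    by_cases ha : G.Adj v w
    · have h1 : v ∈ dirtyNbrs G b w := by simp [dirtyNbrs, hv.1, ha.symm]
      have h2 : w ∈ dirtyNbrs G b v := by simp [dirtyNbrs, hw'.2, ha]
      have h3 := Finset.card_erase_add_one h1
      simp only [fire, hw'.1, h2, if_true, if_false]
      omega
    · have h1 : v ∉ dirtyNbrs G b w := by simp [dirtyNbrs, G.adj_comm w v, ha]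
      have h2 : w ∉ dirtyNbrs G b v := by simp [dirtyNbrs, ha]
      simp [fire, hw'.1, h2, Finset.erase_eq_of_notMem h1]

theorem le_brushes_of_reaches {s t : State V} (h : Reaches G s t) :
    ∀ v ∈ t.dirty, s.brushes v ≤ t.brushes v := by
  classical
  intro v hv
  have h1 := reaches_invariant G h
  have h2 : (dirtyNbrs G t v).card ≤ (dirtyNbrs G s v).card :=
    Finset.card_le_card (Finset.filter_subset_filter _ h1.1)
  have := h1.2 v hv
  omega

theorem subset_of_stable {s t u : State V} (ht : Reaches G s t) (hu : Reaches G s u)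
    (hs : ∀ v, ¬ Ready G u v) : u.dirty ⊆ t.dirty := by
  classical
  induction ht with
  | refl => exact (reaches_invariant G hu).1
  | @tail b c hb hbc ih =>
    obtain ⟨v, hv, rfl⟩ := hbc
    refine fun w hw => Finset.mem_erase.2 ⟨?_, ih hw⟩
    rintro rfl
    have hle : (dirtyNbrs G u w).card ≤ (dirtyNbrs G b w).card :=
      Finset.card_le_card (Finset.filter_subset_filter _ ih)
    have h1 := (reaches_invariant G hu).2 w hw
    have h2 := (reaches_invariant G hb).2 w (ih hw)
    have h3 := hv.2
    exact hs w ⟨hw, by omega⟩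

/-- Every maximal list of firings leaves the same dirty vertices, with the same brushes on them,
so that the choices made in `stabilize` do not matter. -/
theorem stabilize_unique {s t : State V} (h : Reaches G s t) (hs : ∀ v, ¬ Ready G t v) :
    t.dirty = (stabilize G s).dirty ∧
      ∀ v ∈ t.dirty, t.brushes v = (stabilize G s).brushes v := by
  obtain ⟨h1, h2⟩ := reaches_stabilize G s
  have hd : t.dirty = (stabilize G s).dirty :=
    (subset_of_stable G h1 h hs).antisymm (subset_of_stable G h h1 h2)
  refine ⟨hd, fun v hv => ?_⟩
  have e1 := (reaches_invariant G h).2 v hv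
  have e2 := (reaches_invariant G h1).2 v (hd ▸ hv)
  have e3 : dirtyNbrs G t v = dirtyNbrs G (stabilize G s) v := by
    simp only [dirtyNbrs, hd]
  rw [e3] at e1
  omega

end

/-- A bound for the number of turns that can still be played. -/
noncomputable def potential {V : Type*} [Fintype V] (s : State V) : ℕ :=
  ∑ v ∈ s.dirty, (Fintype.card V + 1 - s.brushes v)

theorem turn_decreases {V : Type*} [Fintype V] [DecidableEq V] (G : SimpleGraph V)
    (s : State V) (v : V) (hv : v ∈ s.dirty) :
    potential (turn G s v) + (turn G s v).dirty.card < potential s + s.dirty.card := by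
  obtain ⟨h1, h2⟩ := reaches_stabilize G (addBrush s v)
  have hsub : (turn G s v).dirty ⊆ s.dirty := (reaches_invariant G h1).1
  have hb : ∀ w ∈ (turn G s v).dirty, (addBrush s v).brushes w ≤ (turn G s v).brushes w :=
    le_brushes_of_reaches G h1
  have hs : ∀ w ∈ (turn G s v).dirty, s.brushes w ≤ (turn G s v).brushes w := by
    intro w hw
    refine le_trans ?_ (hb w hw)
    by_cases e : w = v
    · subst e; simp [addBrush]
    · simp [addBrush, e]
  have hP1 : potential (turn G s v) ≤
      ∑ w ∈ (turn G s v).dirty, (Fintype.card V + 1 - s.brushes w) :=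
    Finset.sum_le_sum fun w hw => by have := hs w hw; omega
  have hP2 : ∑ w ∈ (turn G s v).dirty, (Fintype.card V + 1 - s.brushes w) ≤ potential s :=
    Finset.sum_le_sum_of_subset hsub
  by_cases hvt : v ∈ (turn G s v).dirty
  · have hlt : potential (turn G s v) <
        ∑ w ∈ (turn G s v).dirty, (Fintype.card V + 1 - s.brushes w) := by
      refine Finset.sum_lt_sum (fun w hw => by have := hs w hw; omega) ⟨v, hvt, ?_⟩
      have e1 : s.brushes v + 1 ≤ (turn G s v).brushes v := by
        simpa [addBrush] using hb v hvt
      have e2 : (turn G s v).brushes v < (dirtyNbrs G (turn G s v) v).card :=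
        not_le.1 fun hle => h2 v ⟨hvt, hle⟩
      have e3 : (dirtyNbrs G (turn G s v) v).card ≤ Fintype.card V := Finset.card_le_univ _
      omega
    have := Finset.card_le_card hsub
    omega
  · have : (turn G s v).dirty.card < s.dirty.card :=
      Finset.card_lt_card ⟨hsub, fun h => hvt (h hv)⟩
    omega

/-- The number of further turns from position `s` under optimal play, the given player moving
next. A brush may only be placed on a dirty vertex and the game is over once every vertex is
clean; Min minimizes and Max maximizes the number of turns. -/
noncomputable def gameLength {V : Type*} [Fintype V] [DecidableEq V] (G : SimpleGraph V)
    (P : Player) (s : State V) : ℕ :=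
  if h : s.dirty.Nonempty then
    match P with
    | .min => 1 + s.dirty.attach.inf' (Finset.attach_nonempty_iff.2 h)
        fun v => gameLength G .max (turn G s v.1)
    | .max => 1 + s.dirty.attach.sup' (Finset.attach_nonempty_iff.2 h)
        fun v => gameLength G .min (turn G s v.1)
  else 0
termination_by potential s + s.dirty.card
decreasing_by
  all_goals exact turn_decreases G s v.1 v.2

/-- The starting position: every vertex is dirty and there are no brushes; vertices that are
ready at once (the isolated ones) fire. -/
noncomputable def initial {V : Type*} [Fintype V] [DecidableEq V] (G : SimpleGraph V) : State V :=
  stabilize G ⟨Finset.univ, fun _ => 0⟩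

/-- The game brush number: the length of the Min-start game under optimal play. -/
noncomputable def gameBrushNumber {V : Type*} [Fintype V] [DecidableEq V] (G : SimpleGraph V) : ℕ :=
  gameLength G .min (initial G)

end Brushing

/-!
Call the number of brushes on a vertex plus the number of its dirty neighbours its load. Firing
other vertices does not change the load of a dirty vertex, so a dirty vertex fires as soon as its
load reaches twice its number of dirty neighbours. If `p n → ∞`, a Chernoff bound and the union
bound over all `S` and `T` show that, with high probability, all the numbers of edges between two
sets of vertices are within `δ p n²` of `p |S| |T|`. For a graph with this property most vertices
fire at a load close to `2 p |D|`, where `D` is the set of dirty vertices, and the game stays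
close to a deterministic limit.

Upper bound: Min plays in phases, in each of which he cleans the `n / M` dirty vertices of largest
load. With `E = p |D|²` and with `B` the total load of the dirty vertices, the potential
`E - B + E exp (B / E - 2)` drops in each phase by at least the number of turns, up to small
errors. It starts from `E = B = p n²`, where its value is `p n² / e`.

Lower bound: Max always brushes a dirty vertex of least load, so only the brushes of Min add to
the loads above the least one, which limits how many vertices can fire early: when the least load
reaches `p n κ (1 - 2 log κ)`, where `e ^ (-1/2) < κ ≤ 1`, about `κ n` vertices or more are still
dirty. As `κ` tends to `e ^ (-1/2)`, this load tends to `2 p κ n`. The total load at the end of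
the game exceeds that at the start, about `p n²`, by the number of turns. It is at least about the
integral of `2 p n² x` over `κ ≤ x ≤ 1`, for the vertices that have fired by then, plus `κ n`
times `2 p κ n`, for the others. So the number of turns is at least about `p n² κ² = p n² / e`.
-/

namespace Brushing

/-! ### Positions and stretches of play -/

section Load

variable {V : Type*} (G : SimpleGraph V)

/-- The number of brushes on `v` plus the number of its dirty neighbours. Firing other vertices
does not change it, and `v` is ready when it reaches twice the number of dirty neighbours. -/
noncomputable def load (s : State V) (v : V) : ℕ :=
  s.brushes v + (dirtyNbrs G s v).card

/-- No dirty vertex is ready to fire. -/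
def Stable (s : State V) : Prop := ∀ v, ¬ Ready G s v

variable {G} in
theorem Stable.load_lt {s : State V} (hs : Stable G s) {v : V} (hv : v ∈ s.dirty) :
    load G s v < 2 * (dirtyNbrs G s v).card := by
  have : ¬ (dirtyNbrs G s v).card ≤ s.brushes v := fun h => hs v ⟨hv, h⟩
  unfold load
  omega

theorem dirtyNbrs_mono {s t : State V} (h : t.dirty ⊆ s.dirty) (v : V) :
    dirtyNbrs G t v ⊆ dirtyNbrs G s v := by
  classical exact Finset.filter_subset_filter _ h

variable [DecidableEq V]

theorem stable_stabilize (s : State V) : Stable G (stabilize G s) :=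
  (reaches_stabilize G s).2

theorem stabilize_dirty_subset (s : State V) : (stabilize G s).dirty ⊆ s.dirty :=
  (reaches_invariant G (reaches_stabilize G s).1).1

theorem turn_dirty_subset (s : State V) (v : V) : (turn G s v).dirty ⊆ s.dirty :=
  stabilize_dirty_subset G (addBrush s v)

theorem load_addBrush (s : State V) (v w : V) :
    load G (addBrush s v) w = load G s w + if w = v then 1 else 0 := by
  change Function.update s.brushes v _ w + (dirtyNbrs G s w).card = _ + (dirtyNbrs G s w).card + _
  rw [Function.update_apply]
  split_ifs with h
  · rw [h]
    omega
  · rfl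

theorem load_stabilize (s : State V) {w : V} (hw : w ∈ (stabilize G s).dirty) :
    load G (stabilize G s) w = load G s w :=
  (reaches_invariant G (reaches_stabilize G s).1).2 w hw

theorem load_turn (s : State V) (v : V) {w : V} (hw : w ∈ (turn G s v).dirty) :
    load G (turn G s v) w = load G s w + if w = v then 1 else 0 :=
  (load_stabilize G _ hw).trans (load_addBrush G s v w)

end Load

section GameLength

variable {V : Type*} [Fintype V] [DecidableEq V] (G : SimpleGraph V)

theorem gameLength_of_dirty_eq_empty {P : Player} {s : State V} (h : s.dirty = ∅) :
    gameLength G P s = 0 := by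
  rw [gameLength, dif_neg (by simp [h])]

theorem gameLength_min_le {s : State V} {v : V} (hv : v ∈ s.dirty) :
    gameLength G .min s ≤ 1 + gameLength G .max (turn G s v) := by
  rw [gameLength, dif_pos ⟨v, hv⟩]
  exact Nat.add_le_add_left (Finset.inf'_le _ (Finset.mem_attach _ ⟨v, hv⟩)) 1

theorem le_gameLength_max {s : State V} {v : V} (hv : v ∈ s.dirty) :
    1 + gameLength G .min (turn G s v) ≤ gameLength G .max s := by
  conv_rhs => rw [gameLength, dif_pos ⟨v, hv⟩]
  exact Nat.add_le_add_left (Finset.le_sup'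
    (fun v : s.dirty => gameLength G .min (turn G s v.1)) (Finset.mem_attach _ ⟨v, hv⟩)) 1

theorem exists_gameLength_min_eq {s : State V} (h : s.dirty.Nonempty) :
    ∃ v ∈ s.dirty, gameLength G .min s = 1 + gameLength G .max (turn G s v) := by
  obtain ⟨v, -, hv⟩ := Finset.exists_mem_eq_inf' (Finset.attach_nonempty_iff.2 h)
    fun v : s.dirty => gameLength G .max (turn G s v.1)
  refine ⟨v.1, v.2, ?_⟩
  conv_lhs => rw [gameLength, dif_pos h]
  simp only [hv]

theorem exists_gameLength_max_eq {s : State V} (h : s.dirty.Nonempty) :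
    ∃ v ∈ s.dirty, gameLength G .max s = 1 + gameLength G .min (turn G s v) := by
  obtain ⟨v, -, hv⟩ := Finset.exists_mem_eq_sup' (Finset.attach_nonempty_iff.2 h)
    fun v : s.dirty => gameLength G .min (turn G s v.1)
  refine ⟨v.1, v.2, ?_⟩
  conv_lhs => rw [gameLength, dif_pos h]
  simp only [hv]

end GameLength

section Stretch

variable {V : Type*} [Fintype V] [DecidableEq V] {G : SimpleGraph V}

theorem sum_add_ite_eq (f : V → ℕ) (x : V) :
    ∑ v, (f v + if v = x then 1 else 0) = ∑ v, f v + 1 := by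
  simp [Finset.sum_add_distrib]

/-- A stretch of play from the position `s`, with `P` to move, in which Max plays optimally. Of
the individual turns only the number `added v` of brushes put on each vertex `v` is recorded. -/
structure Stretch (G : SimpleGraph V) (P : Player) (s : State V) where
  /-- the final position -/
  last : State V
  /-- the player to move in the final position -/
  next : Player
  /-- the number of brushes that a vertex receives -/
  added : V → ℕ
  stable_last : Stable G last
  last_dirty_subset : last.dirty ⊆ s.dirty
  load_add_le : ∀ v, 0 < added v → v ∈ s.dirty ∧ load G s v + added v ≤ 2 * (dirtyNbrs G s v).card
  load_last : ∀ v ∈ last.dirty, load G last v = load G s v + added v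
  gameLength_le : gameLength G P s ≤ ∑ v, added v + gameLength G next last

namespace Stretch

variable {P Q : Player} {s : State V}

/-- The stretch of length zero. -/
def nil (hs : Stable G s) : Stretch G P s where
  last := s
  next := P
  added _ := 0
  stable_last := hs
  last_dirty_subset := subset_rfl
  load_add_le := by simp
  load_last := by simp
  gameLength_le := by simp

/-- The stretch that starts with a brush on `x` and continues with `σ`. -/
def cons (hs : Stable G s) {x : V} (hx : x ∈ s.dirty)
    (hg : gameLength G P s ≤ 1 + gameLength G Q (turn G s x)) (σ : Stretch G Q (turn G s x)) :
    Stretch G P s where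
  last := σ.last
  next := σ.next
  added v := σ.added v + if v = x then 1 else 0
  stable_last := σ.stable_last
  last_dirty_subset := σ.last_dirty_subset.trans (turn_dirty_subset G s x)
  load_add_le v hv := by
    rcases (σ.added v).eq_zero_or_pos with h0 | hpos
    · obtain rfl : v = x := by
        by_contra hvx
        simp [h0, hvx] at hv
      have := hs.load_lt hx
      exact ⟨hx, by simp only [h0, if_true]; omega⟩
    · obtain ⟨hmem, hle⟩ := σ.load_add_le v hpos
      rw [load_turn G s x hmem] at hle
      have := Finset.card_le_card (dirtyNbrs_mono G (turn_dirty_subset G s x) v)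
      exact ⟨turn_dirty_subset G s x hmem, by omega⟩
  load_last v hv := by
    rw [σ.load_last v hv, load_turn G s x (σ.last_dirty_subset hv)]
    ring
  gameLength_le := by
    have := σ.gameLength_le
    rw [sum_add_ite_eq]
    omega

end Stretch

/-- The number of turns until Min is to move. -/
def Player.turnsToMin : Player → ℕ
  | .min => 0
  | .max => 1

/-- Min puts his brushes on dirty vertices of `S` as long as there are any, so that `S` receives at
least every second brush. -/
theorem exists_stretch_disjoint (S : Finset V) (P : Player) (s : State V) (hs : Stable G s) :
    ∃ σ : Stretch G P s, Disjoint S σ.last.dirty ∧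
      ∑ v, σ.added v ≤ 2 * ∑ v ∈ S, σ.added v + P.turnsToMin := by
  induction hn : potential s + s.dirty.card using Nat.strong_induction_on generalizing s P with
  | _ n ih =>
    by_cases hd : Disjoint S s.dirty
    · exact ⟨.nil hs, hd, by simp [Stretch.nil]⟩
    obtain ⟨x, hxS, hxd⟩ := Finset.not_disjoint_iff.1 hd
    have ih' (Q : Player) (y : V) (hy : y ∈ s.dirty) :=
      ih _ (hn ▸ turn_decreases G s y hy) Q (turn G s y) (stable_stabilize G _) rfl
    cases P with
    | min =>
      obtain ⟨σ, hdisj, hsum⟩ := ih' .max x hxd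
      refine ⟨.cons hs hxd (gameLength_min_le G hxd) σ, hdisj, ?_⟩
      simp only [Stretch.cons, sum_add_ite_eq, Finset.sum_add_distrib (s := S),
        Finset.sum_ite_eq' S x, hxS, if_true, Player.turnsToMin] at hsum ⊢
      omega
    | max =>
      obtain ⟨y, hyd, hy⟩ := exists_gameLength_max_eq G ⟨x, hxd⟩
      obtain ⟨σ, hdisj, hsum⟩ := ih' .min y hyd
      refine ⟨.cons hs hyd hy.le σ, hdisj, ?_⟩
      simp only [Stretch.cons, sum_add_ite_eq, Finset.sum_add_distrib (s := S),
        Player.turnsToMin] at hsum ⊢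
      omega

end Stretch

section DegIn

variable {V : Type*} (G : SimpleGraph V)

open Classical in
/-- The number of neighbours of `v` in `T`. -/
noncomputable def degIn (T : Finset V) (v : V) : ℕ := {w ∈ T | G.Adj v w}.card

theorem degIn_mono {S T : Finset V} (h : S ⊆ T) (v : V) : degIn G S v ≤ degIn G T v := by
  classical exact Finset.card_le_card (Finset.filter_subset_filter _ h)

end DegIn

section FiringOrder

variable {V : Type*} [DecidableEq V] {G : SimpleGraph V} {f g : V → ℕ}

/-- The vertices of the list can fire in this order, the later ones being dirty until then, when
the load of each vertex `v` at the time of its firing is at most `f v`. -/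
def FiringOrder (G : SimpleGraph V) (f : V → ℕ) : List V → Prop
  | [] => True
  | v :: l => v ∉ l ∧ 2 * degIn G l.toFinset v ≤ f v ∧ FiringOrder G f l

theorem FiringOrder.nodup {l : List V} (h : FiringOrder G f l) : l.Nodup := by
  induction l with
  | nil => exact List.nodup_nil
  | cons v l ih => exact List.nodup_cons.2 ⟨h.1, ih h.2.2⟩

theorem FiringOrder.mono {l : List V} (h : FiringOrder G f l) (hfg : ∀ v ∈ l, f v ≤ g v) :
    FiringOrder G g l := by
  induction l with
  | nil => trivial
  | cons v l ih =>
    exact ⟨h.1, h.2.1.trans (hfg v List.mem_cons_self),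
      ih h.2.2 fun u hu => hfg u (List.mem_cons_of_mem v hu)⟩

theorem FiringOrder.two_mul_degIn_le {l : List V} (h : FiringOrder G f l) {v : V} (hv : v ∈ l) :
    2 * degIn G {u ∈ l.toFinset | l.idxOf v < l.idxOf u} v ≤ f v := by
  induction l with
  | nil => simp at hv
  | cons x l ih =>
    obtain ⟨hx, hle, hl⟩ := h
    rcases List.mem_cons.1 hv with rfl | hvl
    · refine le_trans (Nat.mul_le_mul_left 2 (degIn_mono G (fun u hu => ?_) v)) hle
      obtain ⟨hu, hlt⟩ := Finset.mem_filter.1 hu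
      rcases List.mem_cons.1 (List.mem_toFinset.1 hu) with rfl | hul
      · exact absurd hlt (lt_irrefl _)
      · exact List.mem_toFinset.2 hul
    · refine le_trans (Nat.mul_le_mul_left 2 (degIn_mono G (fun u hu => ?_) v)) (ih hl hvl)
      obtain ⟨hu, hlt⟩ := Finset.mem_filter.1 hu
      have hxv : x ≠ v := fun h => hx (h ▸ hvl)
      have hxu : x ≠ u := by
        rintro rfl
        simp at hlt
      rw [List.idxOf_cons_ne _ hxv, List.idxOf_cons_ne _ hxu] at hlt
      have hul := List.mem_of_ne_of_mem hxu.symm (List.mem_toFinset.1 hu)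
      exact Finset.mem_filter.2 ⟨List.mem_toFinset.2 hul, Nat.lt_of_succ_lt_succ hlt⟩

theorem FiringOrder.exists_append_of_reaches {s t : State V} (h : Reaches G s t) {l : List V}
    (hl : FiringOrder G f l) (hlt : l.toFinset = t.dirty) (hf : ∀ v ∈ s.dirty, load G s v ≤ f v) :
    ∃ l', FiringOrder G f (l' ++ l) ∧ (l' ++ l).toFinset = s.dirty := by
  induction h using Relation.ReflTransGen.head_induction_on with
  | refl => exact ⟨[], hl, hlt⟩
  | @head a c hac hct ih =>
    obtain ⟨v, hv, rfl⟩ := hac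
    have hsub : (fire G a v).dirty ⊆ a.dirty := Finset.erase_subset _ _
    have hload : ∀ u ∈ (fire G a v).dirty, load G (fire G a v) u = load G a u :=
      (reaches_invariant G (.single ⟨v, hv, rfl⟩)).2
    obtain ⟨l', hl', hset⟩ := ih fun u hu => (hload u hu).trans_le (hf u (hsub hu))
    have hcons : FiringOrder G f (v :: (l' ++ l)) := by
      refine ⟨fun hmem => ?_, ?_, hl'⟩
      · rw [← List.mem_toFinset, hset] at hmem
        exact Finset.notMem_erase v _ hmem
      · have hdeg : degIn G (l' ++ l).toFinset v ≤ (dirtyNbrs G a v).card :=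
          degIn_mono G (hset.trans_subset hsub) v
        have hfire := hv.2
        have hfv := hf v hv.1
        unfold load at hfv
        omega
    refine ⟨v :: l', hcons, ?_⟩
    rw [List.cons_append, List.toFinset_cons, hset]
    exact Finset.insert_erase hv.1

end FiringOrder

theorem mem_drop_iff_le_idxOf {α : Type*} [BEq α] [LawfulBEq α] {l : List α} (hl : l.Nodup)
    {a : α} (ha : a ∈ l) {k : ℕ} : a ∈ l.drop k ↔ k ≤ l.idxOf a := by
  rw [← not_lt, ← List.mem_take_iff_idxOf_lt ha]
  refine ⟨fun hd ht => List.disjoint_take_drop hl le_rfl ht hd, fun ht => ?_⟩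
  rw [← List.take_append_drop k l, List.mem_append] at ha
  exact ha.resolve_left ht

section GreedyPlay

variable {V : Type*} [DecidableEq V] {G : SimpleGraph V} {P Q : Player} {D : Finset V} {w : V → ℕ}

/-- The initial load `w v` of `v` plus the number of brushes put on `v` in the first `i` of the
moves `mv`. While `v` is dirty, this is its load. -/
def loadAfter (w : V → ℕ) (mv : ℕ → V) (i : ℕ) (v : V) : ℕ :=
  w v + Nat.count (mv · = v) i

/-- A play that starts with `P`, the set `D` of dirty vertices and the loads `w`, and in which Max
always puts his brush on a dirty vertex of least load. The positions are encoded by the order in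
which the vertices fire and the number of vertices fired so far. -/
structure GreedyPlay (G : SimpleGraph V) (P : Player) (D : Finset V) (w : V → ℕ) where
  /-- the number of turns -/
  T : ℕ
  /-- the vertices receiving brushes -/
  mv : ℕ → V
  /-- the vertices of `D` in the order in which they fire -/
  order : List V
  /-- the number of vertices fired before a turn -/
  fired : ℕ → ℕ
  order_toFinset : order.toFinset = D
  fired_mono : Monotone fired
  drop_fired_T : order.drop (fired T) = []
  mv_mem : ∀ i < T, mv i ∈ order.drop (fired i)
  loadAfter_mv_le : ∀ i < T, Odd (i + P.turnsToMin) → ∀ u ∈ order.drop (fired i),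
    loadAfter w mv i (mv i) ≤ loadAfter w mv i u
  firingOrder : FiringOrder G (loadAfter w mv T) order

theorem loadAfter_mono (mv : ℕ → V) (v : V) : Monotone fun i => loadAfter w mv i v :=
  fun _ _ h => Nat.add_le_add_left (Nat.count_monotone _ h) _

theorem loadAfter_succ (mv : ℕ → V) (i : ℕ) (v : V) :
    loadAfter w mv (i + 1) v = loadAfter w mv i v + if mv i = v then 1 else 0 := by
  rw [loadAfter, Nat.count_succ, ← add_assoc, loadAfter]

theorem loadAfter_succ' (mv : ℕ → V) (i : ℕ) (v : V) : loadAfter w mv (i + 1) v =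
    loadAfter (fun u => w u + if u = mv 0 then 1 else 0) (fun i => mv (i + 1)) i v := by
  simp only [loadAfter, Nat.count_succ', eq_comm (a := v)]
  ring

namespace GreedyPlay

/-- The play without turns. -/
def nil [Inhabited V] : GreedyPlay G P ∅ w where
  T := 0
  mv _ := default
  order := []
  fired _ := 0
  order_toFinset := rfl
  fired_mono := monotone_const
  drop_fired_T := rfl
  mv_mem := by simp
  loadAfter_mv_le := by simp
  firingOrder := trivial

/-- The play that starts with a brush on `x`, which does not let any vertex fire, and continues
with `φ`. -/
def cons {x : V} (hx : x ∈ D) (hmin : Odd P.turnsToMin → ∀ u ∈ D, w x ≤ w u)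
    (hPQ : Q.turnsToMin = 1 - P.turnsToMin)
    (φ : GreedyPlay G Q D fun v => w v + if v = x then 1 else 0) : GreedyPlay G P D w where
  T := φ.T + 1
  mv i := i.casesOn x φ.mv
  order := φ.order
  fired i := i.casesOn 0 φ.fired
  order_toFinset := φ.order_toFinset
  fired_mono := by
    rintro (_ | i) (_ | j) hij
    · rfl
    · exact Nat.zero_le _
    · omega
    · exact φ.fired_mono (Nat.le_of_succ_le_succ hij)
  drop_fired_T := φ.drop_fired_T
  mv_mem := by
    rintro (_ | i) hi
    · rwa [← φ.order_toFinset, List.mem_toFinset] at hx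
    · exact φ.mv_mem i (Nat.lt_of_succ_lt_succ hi)
  loadAfter_mv_le := by
    rintro (_ | i) hi hodd u hu
    · rw [zero_add] at hodd
      simpa [loadAfter] using hmin hodd u (φ.order_toFinset ▸ List.mem_toFinset.2 hu)
    · rw [loadAfter_succ', loadAfter_succ']
      refine φ.loadAfter_mv_le i (Nat.lt_of_succ_lt_succ hi) ?_ u hu
      cases P <;> simp_all [Player.turnsToMin, Nat.odd_add_one]
  firingOrder := φ.firingOrder.mono fun v _ =>
    (loadAfter_succ' (w := w) (fun i => i.casesOn x φ.mv) φ.T v).ge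

theorem exists_of_reaches {s t : State V} (h : Reaches G s t) (hw : load G s = w)
    (φ : GreedyPlay G P t.dirty (load G t)) :
    ∃ ψ : GreedyPlay G P s.dirty w, ψ.T = φ.T := by
  subst hw
  have hload : ∀ v ∈ φ.order, ∀ i, loadAfter (load G t) φ.mv i v = loadAfter (load G s) φ.mv i v :=
    fun v hv i => congrArg (· + _) <|
      (reaches_invariant G h).2 v (φ.order_toFinset ▸ List.mem_toFinset.2 hv)
  obtain ⟨l, hl, hset⟩ :=
    (φ.firingOrder.mono fun v hv => (hload v hv _).le).exists_append_of_reaches h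
      φ.order_toFinset fun v _ => Nat.le_add_right _ _
  exact ⟨{
    T := φ.T
    mv := φ.mv
    order := l ++ φ.order
    fired := fun i => l.length + φ.fired i
    order_toFinset := hset
    fired_mono := fun i j hij => Nat.add_le_add_left (φ.fired_mono hij) _
    drop_fired_T := by rw [List.drop_length_add_append, φ.drop_fired_T]
    mv_mem := fun i hi => by
      rw [List.drop_length_add_append]
      exact φ.mv_mem i hi
    loadAfter_mv_le := fun i hi hodd u hu => by
      rw [List.drop_length_add_append] at hu
      rw [← hload _ (List.mem_of_mem_drop (φ.mv_mem i hi)),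
        ← hload u (List.mem_of_mem_drop hu)]
      exact φ.loadAfter_mv_le i hi hodd u hu
    firingOrder := hl }, rfl⟩

end GreedyPlay

theorem exists_greedyPlay_le_gameLength [Fintype V] [Inhabited V] (P : Player) (s : State V) :
    ∃ φ : GreedyPlay G P s.dirty (load G s), φ.T ≤ gameLength G P s := by
  induction hn : potential s + s.dirty.card using Nat.strong_induction_on generalizing s P with
  | _ n ih =>
    rcases s.dirty.eq_empty_or_nonempty with hempty | hne
    · rw [hempty]
      exact ⟨.nil, Nat.zero_le _⟩
    have exists_of_turn (Q : Player) (x : V) (hx : x ∈ s.dirty) :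
        ∃ φ : GreedyPlay G Q s.dirty fun v => load G s v + if v = x then 1 else 0,
          φ.T ≤ gameLength G Q (turn G s x) := by
      obtain ⟨φ, hφ⟩ := ih _ (hn ▸ turn_decreases G s x hx) Q (turn G s x) rfl
      obtain ⟨ψ, hψ⟩ := φ.exists_of_reaches (reaches_stabilize G (addBrush s x)).1
        (funext (load_addBrush G s x))
      exact ⟨ψ, hψ.trans_le hφ⟩
    cases P with
    | min =>
      obtain ⟨x, hx, hlen⟩ := exists_gameLength_min_eq G hne
      obtain ⟨φ, hφ⟩ := exists_of_turn .max x hx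
      exact ⟨.cons hx (by simp [Player.turnsToMin]) rfl φ, by simp only [GreedyPlay.cons]; omega⟩
    | max =>
      obtain ⟨x, hx, hmin⟩ := Finset.exists_min_image s.dirty (load G s) hne
      obtain ⟨φ, hφ⟩ := exists_of_turn .min x hx
      have hlen := le_gameLength_max G hx
      exact ⟨.cons hx (fun _ => hmin) rfl φ, by simp only [GreedyPlay.cons]; omega⟩

/-- A full game in which Min moves first and Max always puts his brush on a dirty vertex of least
load. -/
abbrev FullGreedyPlay [Fintype V] (G : SimpleGraph V) :=
  GreedyPlay G .min Finset.univ (degIn G Finset.univ)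

theorem exists_fullGreedyPlay_le_gameBrushNumber [Fintype V] [Inhabited V] :
    ∃ φ : FullGreedyPlay G, φ.T ≤ gameBrushNumber G := by
  obtain ⟨φ, hφ⟩ := exists_greedyPlay_le_gameLength (G := G) .min (initial G)
  obtain ⟨ψ, hψ⟩ := φ.exists_of_reaches (reaches_stabilize G _).1
    (funext fun v => Nat.zero_add _)
  exact ⟨ψ, hψ.trans_le hφ⟩

end GreedyPlay

section Position

variable {V : Type*} [DecidableEq V] {G : SimpleGraph V} {P : Player} {w : V → ℕ}

namespace GreedyPlay

section

variable {D : Finset V} (φ : GreedyPlay G P D w)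

/-- The vertices that are dirty before turn `i`. -/
def dirty (i : ℕ) : Finset V := (φ.order.drop (φ.fired i)).toFinset

theorem dirty_T : φ.dirty φ.T = ∅ := by rw [dirty, φ.drop_fired_T, List.toFinset_nil]

theorem dirty_anti : Antitone φ.dirty := fun i j hij u hu => by
  have := List.drop_subset_drop_left φ.order (φ.fired_mono hij)
  exact List.mem_toFinset.2 (this (List.mem_toFinset.1 hu))

theorem mv_mem_dirty {i : ℕ} (hi : i < φ.T) : φ.mv i ∈ φ.dirty i :=
  List.mem_toFinset.2 (φ.mv_mem i hi)

end

variable [Fintype V] (φ : GreedyPlay G P Finset.univ w)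

theorem mem_order (v : V) : v ∈ φ.order := by
  rw [← List.mem_toFinset, φ.order_toFinset]
  exact Finset.mem_univ v

theorem length_order : φ.order.length = Fintype.card V := by
  rw [← List.toFinset_card_of_nodup φ.firingOrder.nodup, φ.order_toFinset, Finset.card_univ]

/-- The position of a vertex in the order of firing. -/
def pos : V ≃ Fin (Fintype.card V) :=
  (φ.firingOrder.nodup.getEquivOfForallMemList φ.order φ.mem_order).symm.trans
    (finCongr φ.length_order)

theorem val_pos (v : V) : (φ.pos v : ℕ) = φ.order.idxOf v := rfl

theorem mem_dirty_iff {i : ℕ} {v : V} :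
    v ∈ φ.dirty i ↔ Fintype.card V ≤ φ.pos v + (φ.dirty i).card := by
  have hcard : (φ.dirty i).card = Fintype.card V - φ.fired i := by
    rw [dirty, List.toFinset_card_of_nodup (φ.firingOrder.nodup.sublist (List.drop_sublist _ _)),
      List.length_drop, length_order]
  have hlt := (φ.pos v).2
  rw [hcard, dirty, List.mem_toFinset, mem_drop_iff_le_idxOf φ.firingOrder.nodup (φ.mem_order v),
    ← val_pos]
  omega

/-- The number of neighbours of `v` that fire after `v`. -/
noncomputable def later (v : V) : ℕ := degIn G {u | φ.pos v < φ.pos u} v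

theorem two_mul_later_le (v : V) : 2 * φ.later v ≤ loadAfter w φ.mv φ.T v := by
  have := φ.firingOrder.two_mul_degIn_le (φ.mem_order v)
  rwa [φ.order_toFinset] at this

end GreedyPlay

end Position

section CutBound

variable {V : Type*} {G : SimpleGraph V} {p Δ : ℝ}

theorem degIn_le_add [DecidableEq V] {R S T : Finset V} (h : R ⊆ S ∪ T) (v : V) :
    degIn G R v ≤ degIn G S v + degIn G T v := by
  classical
  refine (degIn_mono G h v).trans ?_
  unfold degIn
  rw [Finset.filter_union]
  exact Finset.card_union_le _ _

/-- The number of pairs in `S × T` joined by an edge differs from `p |S| |T|` by at most `Δ`. -/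
def CutBound (G : SimpleGraph V) (p Δ : ℝ) : Prop :=
  ∀ S T : Finset V, |∑ v ∈ S, (degIn G T v : ℝ) - p * S.card * T.card| ≤ Δ

namespace CutBound

theorem mono {Δ' : ℝ} (hG : CutBound G p Δ) (h : Δ ≤ Δ') : CutBound G p Δ' :=
  fun S T => (hG S T).trans h

theorem nonneg (hG : CutBound G p Δ) : 0 ≤ Δ :=
  (abs_nonneg _).trans (hG ∅ ∅)

theorem sum_abs_le (hG : CutBound G p Δ) (S T : Finset V) :
    ∑ v ∈ S, |(degIn G T v : ℝ) - p * T.card| ≤ 2 * Δ := by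
  set x : V → ℝ := fun v => degIn G T v - p * T.card with hx
  have hsum (A : Finset V) : |∑ v ∈ A, x v| ≤ Δ := by
    convert hG A T using 2
    rw [hx, Finset.sum_sub_distrib, Finset.sum_const, nsmul_eq_mul]
    ring
  calc ∑ v ∈ S, |x v| = ∑ v ∈ S with 0 ≤ x v, x v - ∑ v ∈ S with ¬ 0 ≤ x v, x v := by
        rw [← Finset.sum_filter_add_sum_filter_not S (0 ≤ x ·), sub_eq_add_neg,
          ← Finset.sum_neg_distrib]
        congr 1
        · exact Finset.sum_congr rfl fun v hv => abs_of_nonneg (Finset.mem_filter.1 hv).2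
        · exact Finset.sum_congr rfl fun v hv =>
            abs_of_neg (not_le.1 (Finset.mem_filter.1 hv).2)
    _ ≤ 2 * Δ := by
        have hpos := (abs_le.1 (hsum {v ∈ S | 0 ≤ x v})).2
        have hneg := (abs_le.1 (hsum {v ∈ S | ¬ 0 ≤ x v})).1
        linarith

end CutBound

theorem degIn_top [DecidableEq V] (T : Finset V) (v : V) :
    degIn (⊤ : SimpleGraph V) T v = (T.erase v).card := by
  classical
  unfold degIn
  congr 1
  ext u
  simp [and_comm, ne_comm]

theorem cutBound_top [Fintype V] : CutBound (⊤ : SimpleGraph V) 1 (Fintype.card V) := by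
  classical
  intro S T
  have hdeg (v : V) : (degIn (⊤ : SimpleGraph V) T v : ℝ) = T.card - if v ∈ T then 1 else 0 := by
    rw [degIn_top]
    split_ifs with hv
    · rw [← Finset.card_erase_add_one hv]
      push_cast
      ring
    · rw [Finset.erase_eq_of_notMem hv, sub_zero]
  have hsum : ∑ v ∈ S, (degIn (⊤ : SimpleGraph V) T v : ℝ) - 1 * S.card * T.card =
      -({v ∈ S | v ∈ T} : Finset V).card := by
    simp only [hdeg, Finset.sum_sub_distrib, Finset.sum_const, nsmul_eq_mul, Finset.sum_boole]
    ring
  rw [hsum, abs_neg, Nat.abs_cast]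
  exact_mod_cast Finset.card_le_univ _

end CutBound

section Ordering

theorem sum_filter_equiv_fin {V M : Type*} [Fintype V] [AddCommMonoid M] {n : ℕ} (e : V ≃ Fin n)
    (q : ℕ → Prop) [DecidablePred q] (f : ℕ → M) :
    ∑ v with q (e v), f (e v) = ∑ i ∈ Finset.range n with q i, f i := by
  rw [Finset.sum_filter, Finset.sum_filter, e.sum_comp fun i => if q i then f i else 0,
    Fin.sum_univ_eq_sum_range (fun i => if q i then f i else 0)]

theorem card_filter_equiv_fin {V : Type*} [Fintype V] {n : ℕ} (e : V ≃ Fin n) (q : ℕ → Prop)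
    [DecidablePred q] :
    (Finset.univ.filter fun v => q (e v)).card = ((Finset.range n).filter q).card := by
  simpa only [Finset.card_eq_sum_ones] using sum_filter_equiv_fin e q fun _ => 1

variable {V : Type*} [Fintype V] {G : SimpleGraph V} {p Δ : ℝ} {n : ℕ}

theorem card_filter_le_equiv_fin (e : V ≃ Fin n) (a : ℕ) :
    (Finset.univ.filter fun v => a ≤ e v).card = n - a := by
  rw [card_filter_equiv_fin e (a ≤ ·), ← Nat.card_Ico]
  congr 1
  ext i
  simp [and_comm]

theorem card_filter_le_and_lt_equiv_fin_le (e : V ≃ Fin n) (a m : ℕ) :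
    (Finset.univ.filter fun v => a ≤ e v ∧ e v < a + m).card ≤ m := by
  rw [card_filter_equiv_fin e fun i => a ≤ i ∧ i < a + m]
  calc _ ≤ (Finset.Ico a (a + m)).card :=
        Finset.card_le_card fun i hi => Finset.mem_Ico.2 (Finset.mem_filter.1 hi).2
    _ = m := by simp

theorem abs_degIn_later_sub_le (hp : 0 ≤ p) (e : V ≃ Fin n) {a m : ℕ} {v : V}
    (hav : a ≤ e v) (hva : e v < a + m) :
    |(degIn G {u | e v < e u} v : ℝ) - p * (n - e v)| ≤
      |(degIn G {u | a ≤ e u} v : ℝ) - p * (Finset.univ.filter fun u => a ≤ e u).card| +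
        degIn G {u | a ≤ e u ∧ e u < a + m} v + p * m := by
  classical
  set later : Finset V := {u | e v < e u}
  set R : Finset V := {u | a ≤ e u} with hR
  set B : Finset V := {u | a ≤ e u ∧ e u < a + m}
  have hle : (degIn G later v : ℝ) ≤ degIn G R v := by
    refine Nat.cast_le.2 (degIn_mono G (fun u hu => ?_) v)
    have := Fin.lt_def.1 (Finset.mem_filter.1 hu).2
    exact Finset.mem_filter.2 ⟨Finset.mem_univ u, by omega⟩
  have hge : (degIn G R v : ℝ) ≤ degIn G later v + degIn G B v := by
    refine mod_cast degIn_le_add (fun u hu => ?_) v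
    simp only [later, R, B, Finset.mem_union, Finset.mem_filter, Finset.mem_univ, true_and,
      Fin.lt_def] at hu ⊢
    omega
  have hcard : (R.card : ℝ) = n - a := by
    rw [hR, card_filter_le_equiv_fin, Nat.cast_sub (hav.trans (e v).2.le)]
  have hupper : p * (n - e v) ≤ p * R.card := by
    rw [hcard]
    gcongr
  have hlower : p * R.card ≤ p * (n - e v) + p * m := by
    rw [hcard, ← mul_add]
    have : ((e v : ℕ) : ℝ) ≤ a + m := mod_cast hva.le
    gcongr
    linarith
  have hneg := neg_abs_le ((degIn G R v : ℝ) - p * R.card)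
  have hpos := le_abs_self ((degIn G R v : ℝ) - p * R.card)
  have hB : (0 : ℝ) ≤ degIn G B v := by positivity
  have hpm : 0 ≤ p * m := by positivity
  rw [abs_le]
  constructor <;> linarith

theorem CutBound.sum_abs_later_block_le (hG : CutBound G p Δ) (hp : 0 ≤ p) (e : V ≃ Fin n)
    (a m : ℕ) :
    ∑ v with a ≤ e v ∧ e v < a + m, |(degIn G {u | e v < e u} v : ℝ) - p * (n - e v)| ≤
      3 * Δ + 2 * p * m ^ 2 := by
  set R : Finset V := {u | a ≤ e u}
  set B : Finset V := {u | a ≤ e u ∧ e u < a + m}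
  have hB : (B.card : ℝ) ≤ m := mod_cast card_filter_le_and_lt_equiv_fin_le e a m
  calc ∑ v ∈ B, |(degIn G {u | e v < e u} v : ℝ) - p * (n - e v)|
      ≤ ∑ v ∈ B, (|(degIn G R v : ℝ) - p * R.card| + degIn G B v + p * m) := by
        refine Finset.sum_le_sum fun v hv => ?_
        obtain ⟨hav, hva⟩ := (Finset.mem_filter.1 hv).2
        exact abs_degIn_later_sub_le hp e hav hva
    _ = ∑ v ∈ B, |(degIn G R v : ℝ) - p * R.card| + ∑ v ∈ B, (degIn G B v : ℝ) +
        B.card * (p * m) := by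
        rw [Finset.sum_add_distrib, Finset.sum_add_distrib, Finset.sum_const, nsmul_eq_mul]
    _ ≤ 2 * Δ + (p * m * m + Δ) + m * (p * m) := by
        have hBR := hG.sum_abs_le B R
        have hBB := (abs_le.1 (hG B B)).2
        have : p * B.card * B.card ≤ p * m * m := by gcongr
        have : B.card * (p * m) ≤ m * (p * m) := by gcongr
        linarith
    _ = _ := by ring

theorem CutBound.sum_abs_later_le (hG : CutBound G p Δ) (hp : 0 ≤ p) (e : V ≃ Fin n) {M m : ℕ}
    (hm : 0 < m) (hn : n ≤ M * m) :
    ∑ v, |(degIn G {u | e v < e u} v : ℝ) - p * (n - e v)| ≤ M * (3 * Δ + 2 * p * m ^ 2) := by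
  have hmaps (v : V) (_ : v ∈ Finset.univ) : (e v : ℕ) / m ∈ Finset.range M := by
    rw [Finset.mem_range, Nat.div_lt_iff_lt_mul hm]
    exact (e v).2.trans_le hn
  have hblock (b : ℕ) (v : V) : (e v : ℕ) / m = b ↔ b * m ≤ e v ∧ e v < b * m + m := by
    rw [Nat.div_eq_iff hm]
    omega
  rw [← Finset.sum_fiberwise_of_maps_to hmaps]
  simp only [hblock]
  refine (Finset.sum_le_card_nsmul _ _ _ fun b _ => hG.sum_abs_later_block_le hp e _ m).trans_eq ?_
  rw [Finset.card_range, nsmul_eq_mul]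

end Ordering

/-! ### The upper bound -/

section Potential

open Real

/-- The potential of the limiting game in which `E` counts the ordered dirty edges and `B` the
total load of the dirty vertices. -/
noncomputable def pot (E B : ℝ) : ℝ := E - B + E * exp (B / E - 2)

variable {E E' B B' W W' t err z p m k e : ℝ}

theorem pot_nonneg (hE : 0 < E) : 0 ≤ pot E B := by
  have h := mul_le_mul_of_nonneg_left (add_one_le_exp (B / E - 2)) hE.le
  have hlin : E * (B / E - 2 + 1) = B - E := by field_simp; ring
  unfold pot
  linarith

/-- `pot` is convex, and so lies above its tangent plane at `(E', B')`. -/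
theorem pot_tangent (hE : 0 < E) (hE' : 0 < E') (hz : z = 2 - B' / E') :
    pot E' B' + (E - E') * (1 + exp (-z) * (z - 1)) - (B - B') * (1 - exp (-z)) ≤ pot E B := by
  have hB' : B' = E' * (2 - z) := by rw [hz]; field_simp; ring
  have hquot : B' / E' = 2 - z := by rw [hz]; ring
  have hpot : pot E' B' = E' - B' + E' * exp (-z) := by
    rw [pot, hquot]
    ring_nf
  have hexp : exp (B / E - 2) = exp (-z) * exp (B / E - (2 - z)) := by
    rw [← exp_add]
    ring_nf
  have hline := mul_le_mul_of_nonneg_left (add_one_le_exp (B / E - (2 - z)))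
    (mul_nonneg hE.le (exp_pos (-z)).le)
  have hmul : E * exp (-z) * (B / E - (2 - z) + 1) = exp (-z) * (B + E * (z - 1)) := by
    field_simp
    ring
  rw [hmul] at hline
  rw [hpot, pot, hexp, hB']
  linarith

theorem pot_anti (hE : 0 < E) (h : B' ≤ B) (hB : B ≤ 2 * E) : pot E B ≤ pot E B' := by
  have htangent := pot_tangent (E := E) (B := B') (E' := E) (B' := B) hE hE rfl
  have hexp : exp (-(2 - B / E)) ≤ 1 := by
    rw [exp_le_one_iff, neg_nonpos, sub_nonneg, div_le_iff₀ hE]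
    exact hB
  nlinarith

theorem pot_add_le_of_tangent (hE : 0 < E) (hE' : 0 < E') (hBW : B ≤ W') (hW' : W' ≤ 2 * E')
    (hz : z = 2 - B / E')
    (h : t ≤ (E - E') * (1 + exp (-z) * (z - 1)) - (W - B) * (1 - exp (-z)) + err) :
    pot E' W' + t ≤ pot E W + err := by
  have hanti := pot_anti hE' hBW hW'
  have htangent := pot_tangent (B := W) hE hE' hz
  linarith

theorem two_sub_le_exp_neg_mul (hz : 0 ≤ z) : 2 - z ≤ exp (-z) * (2 + z) := by
  have hderiv (x : ℝ) : HasDerivAt (fun x => x - 2 + exp (-x) * (2 + x))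
      (1 - exp (-x) * (1 + x)) x :=
    (((hasDerivAt_id x).sub_const 2).add
      ((hasDerivAt_neg x).exp.mul ((hasDerivAt_id x).const_add 2))).congr_deriv (by simp; ring)
  have hmono : Monotone fun x : ℝ => x - 2 + exp (-x) * (2 + x) := by
    refine monotone_of_deriv_nonneg (fun x => (hderiv x).differentiableAt) fun x => ?_
    rw [(hderiv x).deriv, sub_nonneg, exp_neg, inv_mul_le_iff₀ (exp_pos x), mul_one, add_comm]
    exact add_one_le_exp x
  have := hmono hz
  simp only [neg_zero, exp_zero] at this
  linarith

theorem nonneg_of_le_two_mul (hE : 0 < E) (hB : B ≤ 2 * E) (hz : z = 2 - B / E) : 0 ≤ z := by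
  rw [hz, sub_nonneg, div_le_iff₀ hE]
  exact hB

theorem div_le_div_add_of_le (hp : 0 < p) (hm : 0 < m) (hk : m ≤ k)
    (hW : W ≤ 2 * p * (k + m) ^ 2) (hB : B ≤ W + m * (2 * p * (k + m))) :
    B / k ≤ W / (k + m) + 8 * p * m := by
  have hk0 : 0 < k := hm.trans_le hk
  have hkm : 0 < k + m := by linarith
  have hpm : 0 ≤ p * m := by positivity
  have hWk : W / k ≤ W / (k + m) + 4 * p * m := by
    rw [div_add' _ _ _ hkm.ne', div_le_div_iff₀ hk0 hkm]
    have hWm : W * m ≤ 2 * p * (k + m) ^ 2 * m := by gcongr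
    have : 2 * p * (k + m) ^ 2 * m ≤ 4 * p * m * (k + m) * k := by
      nlinarith [mul_nonneg hpm hkm.le]
    linarith
  have hmk : m * (2 * p * (k + m)) / k ≤ 4 * p * m := by
    rw [div_le_iff₀ hk0]
    nlinarith
  calc B / k ≤ (W + m * (2 * p * (k + m))) / k := by gcongr
    _ = W / k + m * (2 * p * (k + m)) / k := add_div _ _ _
    _ ≤ _ := by linarith

/-- A phase of `t` turns in which `m` of `k + m` vertices are cleaned, of average load at least the
overall average `W / (k + m)`, when no load at the end exceeds the new threshold `2 * p * k`. -/
theorem pot_step_unsaturated (hp : 0 < p) (hm : 0 < m) (hk : m ≤ k) (he : 0 ≤ e) (hW : 0 ≤ W)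
    (hW2 : W ≤ 2 * p * (k + m) ^ 2)
    (ht : t ≤ 2 * (m * (2 * p * (k + m)) - m * (W / (k + m))) + 4 * e + 1)
    (hW' : W + t - m * (2 * p * (k + m)) - (6 * e + 4 * p * m ^ 2 + 1) ≤ W')
    (hW'2 : W' ≤ 2 * (p * k ^ 2)) :
    pot (p * k ^ 2) W' + t ≤ pot (p * (k + m) ^ 2) W + (26 * p * m ^ 2 + 10 * e + 2) := by
  have hk0 : 0 < k := hm.trans_le hk
  have hE : 0 < p * k ^ 2 := by positivity
  have hpm : 0 ≤ p * m ^ 2 := by positivity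
  set B := W + t - m * (2 * p * (k + m)) - (6 * e + 4 * p * m ^ 2 + 1) with hB
  set z := 2 - B / (p * k ^ 2) with hz
  have hz0 : 0 ≤ z := nonneg_of_le_two_mul hE (hW'.trans hW'2) rfl
  set q := exp (-z)
  have hq0 : 0 ≤ q := (exp_pos _).le
  have hq1 : q ≤ 1 := exp_le_one_iff.2 (neg_nonpos.2 hz0)
  have ht_le : t - 2 * m * (p * k * z) ≤ 20 * p * m ^ 2 + 4 * e + 1 := by
    have hWkm : 0 ≤ m * (W / (k + m)) := by positivity
    have hBk := div_le_div_add_of_le hp hm hk hW2 (B := B) (by linarith)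
    have hpkz : p * k * z = 2 * p * k - B / k := by rw [hz]; field_simp
    rw [hpkz]
    have := mul_le_mul_of_nonneg_left hBk (by positivity : 0 ≤ 2 * m)
    linarith
  refine pot_add_le_of_tangent (by positivity) hE hW' hW'2 hz ?_
  have hgain : (p * (k + m) ^ 2 - p * k ^ 2) * (1 + q * (z - 1)) - (W - B) * (1 - q) =
      t - q * (t - 2 * m * (p * k * z)) + p * m ^ 2 * (1 - q + q * z)
        - (1 - q) * (6 * p * m ^ 2 + 6 * e + 1) := by
    rw [hB]
    ring
  have hqt : q * (t - 2 * m * (p * k * z)) ≤ 20 * p * m ^ 2 + 4 * e + 1 :=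
    (mul_le_mul_of_nonneg_left ht_le hq0).trans (mul_le_of_le_one_left (by positivity) hq1)
  have hsq : 0 ≤ p * m ^ 2 * (1 - q + q * z) :=
    mul_nonneg hpm (add_nonneg (sub_nonneg.2 hq1) (mul_nonneg hq0 hz0))
  have herr : 0 ≤ q * (6 * p * m ^ 2 + 6 * e + 1) := by positivity
  linarith

/-- A phase of `t` turns in which `m` of `k + m` vertices are cleaned, all of load at least the new
threshold `2 * p * k`. -/
theorem pot_step_saturated (hp : 0 < p) (hm : 0 < m) (hk : m ≤ k) (he : 0 ≤ e)
    (ht : t ≤ 4 * p * m ^ 2 + 4 * e + 1)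
    (hW' : k * (W - m * (2 * p * (k + m)) - 2 * e) ≤ (k + m) * W')
    (hW'2 : W' ≤ 2 * (p * k ^ 2)) :
    pot (p * k ^ 2) W' + t ≤ pot (p * (k + m) ^ 2) W + (26 * p * m ^ 2 + 10 * e + 2) := by
  have hk0 : 0 < k := hm.trans_le hk
  have hkm : 0 < k + m := by linarith
  have hE : 0 < p * k ^ 2 := by positivity
  have hpm : 0 ≤ p * m ^ 2 := by positivity
  set B := k * (W - m * (2 * p * (k + m)) - 2 * e) / (k + m) with hB
  have hBW : B ≤ W' := by rw [hB, div_le_iff₀ hkm]; linarith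
  set z := 2 - B / (p * k ^ 2) with hz
  have hz0 : 0 ≤ z := nonneg_of_le_two_mul hE (hBW.trans hW'2) rfl
  set q := exp (-z)
  have hq0 : 0 ≤ q := (exp_pos _).le
  have hq1 : q ≤ 1 := exp_le_one_iff.2 (neg_nonpos.2 hz0)
  have hWB : W - B = p * m * k * (4 - z) + 2 * p * m ^ 2 + 2 * e := by
    have hWeq : W = B * (k + m) / k + m * (2 * p * (k + m)) + 2 * e := by
      rw [hB]; field_simp; ring
    have hBz : B = p * k ^ 2 * (2 - z) := by rw [hz]; field_simp; ring
    rw [hWeq, hBz]; field_simp; ring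
  refine pot_add_le_of_tangent (by positivity) hE hBW hW'2 hz ?_
  have hgain : (p * (k + m) ^ 2 - p * k ^ 2) * (1 + q * (z - 1)) - (W - B) * (1 - q) =
      p * m * k * (q * (2 + z) - (2 - z)) + p * m ^ 2 * (1 - q + q * z)
        - (1 - q) * (2 * p * m ^ 2 + 2 * e) := by
    rw [hWB]
    ring
  have hmain : 0 ≤ p * m * k * (q * (2 + z) - (2 - z)) :=
    mul_nonneg (by positivity) (sub_nonneg.2 (two_sub_le_exp_neg_mul hz0))
  have hsq : 0 ≤ p * m ^ 2 * (1 - q + q * z) :=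
    mul_nonneg hpm (add_nonneg (sub_nonneg.2 hq1) (mul_nonneg hq0 hz0))
  have herr : 0 ≤ q * (2 * p * m ^ 2 + 2 * e) := by positivity
  linarith

end Potential

section TopSubset

variable {V : Type*} [DecidableEq V]

theorem exists_top_subset {α : Type*} [LinearOrder α] (f : V → α) (D : Finset V) {m : ℕ}
    (hm : m ≤ D.card) : ∃ S ⊆ D, S.card = m ∧ ∀ x ∈ S, ∀ y ∈ D \ S, f y ≤ f x := by
  induction m with
  | zero => exact ⟨∅, by simp, by simp, by simp⟩
  | succ m ih =>
    obtain ⟨S, hSD, hcard, htop⟩ := ih (by omega)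
    have hne : (D \ S).Nonempty := by
      rw [← Finset.card_pos, Finset.card_sdiff_of_subset hSD]
      omega
    obtain ⟨x, hx, hmax⟩ := Finset.exists_max_image (D \ S) f hne
    obtain ⟨hxD, hxS⟩ := Finset.mem_sdiff.1 hx
    refine ⟨insert x S, Finset.insert_subset hxD hSD, by simp [hxS, hcard], fun a ha y hy => ?_⟩
    have hy' : y ∈ D \ S := Finset.sdiff_subset_sdiff subset_rfl (Finset.subset_insert x S) hy
    rcases Finset.mem_insert.1 ha with rfl | haS
    · exact hmax y hy'
    · exact htop a haS y hy'

theorem card_mul_sum_le_of_top {R : Type*} [CommRing R] [LinearOrder R] [IsStrictOrderedRing R]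
    {f : V → R} {D S : Finset V} (hSD : S ⊆ D) (htop : ∀ x ∈ S, ∀ y ∈ D \ S, f y ≤ f x) :
    S.card * ∑ v ∈ D, f v ≤ D.card * ∑ v ∈ S, f v := by
  have hsum : ∑ _x ∈ S, ∑ y ∈ D \ S, f y ≤ ∑ x ∈ S, ∑ _y ∈ D \ S, f x :=
    Finset.sum_le_sum fun x hx => Finset.sum_le_sum fun y hy => htop x hx y hy
  simp only [Finset.sum_const, nsmul_eq_mul, ← Finset.mul_sum] at hsum
  rw [Finset.card_sdiff_of_subset hSD, Nat.cast_sub (Finset.card_le_card hSD)] at hsum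
  rw [← Finset.sum_sdiff hSD]
  linarith

end TopSubset

section Phase

theorem min_sub_le_div {a b c : ℝ} (ha : 0 < a) (hb : 0 ≤ b) :
    min b (c - a) ≤ c * b / (a + b) := by
  rw [le_div_iff₀ (by linarith)]
  rcases le_total b (c - a) with h | h
  · rw [min_eq_left h]
    nlinarith
  · rw [min_eq_right h]
    nlinarith

theorem min_add_le_min_add_div {u x a c c' : ℝ} (hux : u ≤ x) (hx : x < c') (hc : c' ≤ c)
    (ha : 0 ≤ a) : min (u + a) c ≤ min (u + a) c' + a * (c - c') / (c - x) := by
  have hcx : 0 < c - x := by linarith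
  have hcc : 0 ≤ c - c' := by linarith
  have hloss : 0 ≤ a * (c - c') / (c - x) := by positivity
  rcases le_total (u + a) c' with h | h
  · rw [min_eq_left h]
    linarith [min_le_left (u + a) c]
  · have hmin := min_sub_le_div (c := a) (sub_pos.2 hx) hcc
    rw [show c' - x + (c - c') = c - x by ring] at hmin
    rw [min_eq_right h]
    have : min (u + a) c - c' ≤ min (c - c') (a - (c' - x)) :=
      le_min (by linarith [min_le_right (u + a) c]) (by linarith [min_le_left (u + a) c])
    linarith

variable {V : Type*} [DecidableEq V] {p e : ℝ} {D S : Finset V} {w a dev : V → ℝ}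

/-- What one phase of Min's strategy amounts to: the vertices `S` of largest load `w` in `D` are
cleaned, the vertices `v` receive `a v` brushes each, and `dev v` bounds how far the number of
neighbours of `v` in `D` is from its expected value `p |D|`. -/
structure Phase (p e : ℝ) (D S : Finset V) (w a dev : V → ℝ) : Prop where
  subset : S ⊆ D
  two_mul_card_le : 2 * S.card ≤ D.card
  card_pos : 0 < S.card
  top : ∀ x ∈ S, ∀ y ∈ D \ S, w y ≤ w x
  load_nonneg : ∀ v, 0 ≤ w v
  load_le : ∀ v, w v ≤ 2 * p * D.card
  added_nonneg : ∀ v, 0 ≤ a v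
  dev_nonneg : ∀ v, 0 ≤ dev v
  load_add_le : ∀ v ∈ D, w v + a v ≤ 2 * p * D.card + 2 * dev v
  sum_dev_le : ∑ v ∈ D, dev v ≤ e
  sum_added_le : ∑ v ∈ D, a v ≤ 2 * ∑ v ∈ S, a v + 1

namespace Phase

theorem error_nonneg (h : Phase p e D S w a dev) : 0 ≤ e :=
  (Finset.sum_nonneg fun v _ => h.dev_nonneg v).trans h.sum_dev_le

theorem cast_card_eq (h : Phase p e D S w a dev) : (D.card : ℝ) = (D \ S).card + S.card :=
  mod_cast (Finset.card_sdiff_add_card_eq_card h.subset).symm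

theorem card_le_card_sdiff (h : Phase p e D S w a dev) : (S.card : ℝ) ≤ (D \ S).card := by
  have := h.two_mul_card_le
  rw [Finset.card_sdiff_of_subset h.subset]
  exact_mod_cast (by omega : S.card ≤ D.card - S.card)

theorem sum_added_le_sub_sum_load (h : Phase p e D S w a dev) :
    ∑ v ∈ D, a v ≤ 2 * (S.card * (2 * p * D.card) - ∑ v ∈ S, w v) + 4 * e + 1 := by
  have hS : ∑ v ∈ S, (w v + a v) ≤ ∑ v ∈ S, (2 * p * D.card + 2 * dev v) :=
    Finset.sum_le_sum fun v hv => h.load_add_le v (h.subset hv)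
  rw [Finset.sum_add_distrib, Finset.sum_add_distrib, Finset.sum_const, nsmul_eq_mul,
    ← Finset.mul_sum] at hS
  have hdev : ∑ v ∈ S, dev v ≤ ∑ v ∈ D, dev v :=
    Finset.sum_le_sum_of_subset_of_nonneg h.subset fun v _ _ => h.dev_nonneg v
  linarith [h.sum_dev_le, h.sum_added_le]

theorem le_sum_min (h : Phase p e D S w a dev) :
    ∑ v ∈ D, w v + ∑ v ∈ D, a v - S.card * (2 * p * D.card) - 2 * e ≤
      ∑ v ∈ D \ S, min (w v + a v) (2 * p * D.card) := by
  have hrest : ∑ v ∈ D \ S, (w v + a v - 2 * dev v) ≤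
      ∑ v ∈ D \ S, min (w v + a v) (2 * p * D.card) := by
    refine Finset.sum_le_sum fun v hv => le_min ?_ ?_
    · linarith [h.dev_nonneg v]
    · linarith [h.load_add_le v (Finset.mem_sdiff.1 hv).1]
  have hS : ∑ v ∈ S, (w v + a v - 2 * dev v) ≤ S.card * (2 * p * D.card) := by
    rw [← nsmul_eq_mul]
    exact Finset.sum_le_card_nsmul _ _ _ fun v hv => by linarith [h.load_add_le v (h.subset hv)]
  have hsplit := Finset.sum_sdiff (f := fun v => w v + a v - 2 * dev v) h.subset
  have hD : ∑ v ∈ D, (w v + a v - 2 * dev v) =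
      ∑ v ∈ D, w v + ∑ v ∈ D, a v - 2 * ∑ v ∈ D, dev v := by
    rw [Finset.sum_sub_distrib, Finset.sum_add_distrib, ← Finset.mul_sum]
  linarith [h.sum_dev_le]

variable {W : ℝ}

theorem pot_add_le_of_saturated (h : Phase p e D S w a dev) (hp : 0 < p)
    (hsat : ∀ v ∈ S, 2 * p * (D \ S).card ≤ w v)
    (hW : ∑ v ∈ D \ S, min (w v + a v) (2 * p * (D \ S).card) ≤ W)
    (hW2 : W ≤ 2 * (p * (D \ S).card ^ 2)) :
    pot (p * (D \ S).card ^ 2) W + ∑ v ∈ D, a v ≤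
      pot (p * D.card ^ 2) (∑ v ∈ D, w v) + (26 * p * S.card ^ 2 + 10 * e + 2) := by
  have hk := h.card_le_card_sdiff
  have hS : S.card * (2 * p * (D \ S).card) ≤ ∑ v ∈ S, w v := by
    rw [← nsmul_eq_mul]
    exact Finset.card_nsmul_le_sum S w _ hsat
  have hadd := h.sum_added_le_sub_sum_load
  have hmin := h.le_sum_min
  have hw := h.load_nonneg
  have ha := h.added_nonneg
  have hsum : 0 ≤ ∑ v ∈ D, a v := Finset.sum_nonneg fun v _ => ha v
  rw [h.cast_card_eq] at hadd hmin ⊢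
  set m : ℝ := (S.card : ℝ) with hm
  set k : ℝ := ((D \ S).card : ℝ)
  have hm0 : 0 < m := Nat.cast_pos.2 h.card_pos
  have hscale (v : V) : k * min (w v + a v) (2 * p * (k + m)) ≤
      (k + m) * min (w v + a v) (2 * p * k) := by
    have := add_nonneg (hw v) (ha v)
    rw [mul_min_of_nonneg _ _ (by linarith : 0 ≤ k + m)]
    refine le_min ?_ ?_
    · exact mul_le_mul (by linarith) (min_le_left _ _) (le_min this (by positivity)) (by linarith)
    · exact (mul_le_mul_of_nonneg_left (min_le_right _ _) (by linarith)).trans_eq (by ring)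
  have hsum_scale := Finset.sum_le_sum fun v (_ : v ∈ D \ S) => hscale v
  rw [← Finset.mul_sum, ← Finset.mul_sum] at hsum_scale
  refine pot_step_saturated hp hm0 hk h.error_nonneg (by linarith) ?_ hW2
  calc _ ≤ k * ∑ v ∈ D \ S, min (w v + a v) (2 * p * (k + m)) :=
        mul_le_mul_of_nonneg_left (by linarith) (by linarith)
    _ ≤ _ := hsum_scale.trans (mul_le_mul_of_nonneg_left hW (by linarith))

theorem sum_added_mul_div_le (h : Phase p e D S w a dev) (hp : 0 < p) {x : ℝ}
    (hxS : ∀ v ∈ S, x ≤ w v) (hx : x < 2 * p * (D \ S).card) :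
    (∑ v ∈ D \ S, a v) * (2 * p * S.card) / (2 * p * D.card - x) ≤
      4 * p * S.card ^ 2 + 4 * e + 1 := by
  have hadd := h.sum_added_le_sub_sum_load
  have hS : S.card * x ≤ ∑ v ∈ S, w v := by
    rw [← nsmul_eq_mul]
    exact Finset.card_nsmul_le_sum S w _ hxS
  have hsub : ∑ v ∈ D \ S, a v ≤ ∑ v ∈ D, a v :=
    Finset.sum_le_sum_of_subset_of_nonneg Finset.sdiff_subset fun v _ _ => h.added_nonneg v
  have he := h.error_nonneg
  rw [h.cast_card_eq] at hadd ⊢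
  set m : ℝ := (S.card : ℝ) with hm
  set k : ℝ := ((D \ S).card : ℝ)
  have hm0 : 0 < m := Nat.cast_pos.2 h.card_pos
  have hpm : 0 < 2 * p * m := by positivity
  have hgap : 2 * p * m ≤ 2 * p * (k + m) - x := by linarith
  rw [div_le_iff₀ (hpm.trans_le hgap)]
  calc (∑ v ∈ D \ S, a v) * (2 * p * m)
      ≤ (2 * m * (2 * p * (k + m) - x) + 4 * e + 1) * (2 * p * m) := by gcongr; linarith
    _ = 4 * p * m ^ 2 * (2 * p * (k + m) - x) + (4 * e + 1) * (2 * p * m) := by ring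
    _ ≤ 4 * p * m ^ 2 * (2 * p * (k + m) - x) + (4 * e + 1) * (2 * p * (k + m) - x) := by gcongr
    _ = _ := by ring

theorem pot_add_le_of_unsaturated (h : Phase p e D S w a dev) (hp : 0 < p) {x : V} (hxS : x ∈ S)
    (hmin : ∀ v ∈ S, w x ≤ w v) (hx : w x < 2 * p * (D \ S).card)
    (hW : ∑ v ∈ D \ S, min (w v + a v) (2 * p * (D \ S).card) ≤ W)
    (hW2 : W ≤ 2 * (p * (D \ S).card ^ 2)) :
    pot (p * (D \ S).card ^ 2) W + ∑ v ∈ D, a v ≤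
      pot (p * D.card ^ 2) (∑ v ∈ D, w v) + (26 * p * S.card ^ 2 + 10 * e + 2) := by
  have hm0 : (0 : ℝ) < S.card := Nat.cast_pos.2 h.card_pos
  have hgap : 2 * p * (D.card : ℝ) - 2 * p * (D \ S).card = 2 * p * S.card := by
    rw [h.cast_card_eq]
    ring
  have hloss : ∑ v ∈ D \ S, min (w v + a v) (2 * p * D.card) ≤
      ∑ v ∈ D \ S, min (w v + a v) (2 * p * (D \ S).card) +
        (∑ v ∈ D \ S, a v) * (2 * p * S.card) / (2 * p * D.card - w x) := by
    rw [Finset.sum_mul, Finset.sum_div, ← Finset.sum_add_distrib, ← hgap]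
    exact Finset.sum_le_sum fun v hv => min_add_le_min_add_div (h.top x hxS v hv) hx
      (sub_nonneg.1 (hgap ▸ by positivity)) (h.added_nonneg v)
  have hlost := h.sum_added_mul_div_le hp hmin hx
  have hsum := h.le_sum_min
  have hadd := h.sum_added_le_sub_sum_load
  have hmean : S.card * ((∑ v ∈ D, w v) / D.card) ≤ ∑ v ∈ S, w v := by
    have := h.two_mul_card_le
    have hD : (0 : ℝ) < D.card := Nat.cast_pos.2 (by have := h.card_pos; omega)
    rw [← mul_div_assoc, div_le_iff₀ hD, mul_comm _ (D.card : ℝ)]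
    exact card_mul_sum_le_of_top h.subset h.top
  have hW0 : ∑ v ∈ D, w v ≤ 2 * p * D.card ^ 2 :=
    (Finset.sum_le_card_nsmul _ _ _ fun v _ => h.load_le v).trans_eq (by rw [nsmul_eq_mul]; ring)
  rw [h.cast_card_eq] at *
  exact pot_step_unsaturated hp hm0 h.card_le_card_sdiff h.error_nonneg
    (Finset.sum_nonneg fun v _ => h.load_nonneg v) hW0 (by linarith) (by linarith) hW2

theorem pot_add_le (h : Phase p e D S w a dev) (hp : 0 < p)
    (hW : ∑ v ∈ D \ S, min (w v + a v) (2 * p * (D \ S).card) ≤ W)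
    (hW2 : W ≤ 2 * (p * (D \ S).card ^ 2)) :
    pot (p * (D \ S).card ^ 2) W + ∑ v ∈ D, a v ≤
      pot (p * D.card ^ 2) (∑ v ∈ D, w v) + (26 * p * S.card ^ 2 + 10 * e + 2) := by
  obtain ⟨x, hxS, hmin⟩ := Finset.exists_min_image S w (Finset.card_pos.1 h.card_pos)
  rcases le_or_gt (2 * p * (D \ S).card) (w x) with hx | hx
  · exact h.pot_add_le_of_saturated hp (fun v hv => hx.trans (hmin v hv)) hW hW2
  · exact h.pot_add_le_of_unsaturated hp hxS hmin hx hW hW2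

end Phase

end Phase

section Upper

variable {V : Type*} [DecidableEq V] {G : SimpleGraph V} {p Δ : ℝ} {D : Finset V} {s : State V}

/-- The load of a vertex, cut off at the value `2 p |D|` at which it is expected to fire when the
dirty set is `D`. Clean vertices count as fully loaded. -/
noncomputable def cutLoad (G : SimpleGraph V) (p : ℝ) (D : Finset V) (s : State V) (v : V) : ℝ :=
  if v ∈ s.dirty then min (load G s v : ℝ) (2 * p * D.card) else 2 * p * D.card

theorem cutLoad_of_mem {v : V} (hv : v ∈ s.dirty) :
    cutLoad G p D s v = min (load G s v : ℝ) (2 * p * D.card) :=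
  if_pos hv

theorem cutLoad_le (v : V) : cutLoad G p D s v ≤ 2 * p * D.card := by
  unfold cutLoad
  split_ifs
  · exact min_le_right _ _
  · exact le_rfl

theorem cutLoad_nonneg (hp : 0 ≤ p) (v : V) : 0 ≤ cutLoad G p D s v := by
  unfold cutLoad
  split_ifs <;> positivity

theorem sum_cutLoad_le : ∑ v ∈ D, cutLoad G p D s v ≤ 2 * (p * D.card ^ 2) :=
  (Finset.sum_le_card_nsmul _ _ _ fun v _ => cutLoad_le v).trans_eq (by rw [nsmul_eq_mul]; ring)

variable [Fintype V] {P : Player}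

namespace Stretch

theorem added_eq_zero (σ : Stretch G P s) {v : V} (hv : v ∉ s.dirty) : σ.added v = 0 :=
  Nat.eq_zero_of_not_pos fun h => hv (σ.load_add_le v h).1

theorem sum_added_eq (σ : Stretch G P s) (hD : s.dirty ⊆ D) :
    ∑ v ∈ D, σ.added v = ∑ v, σ.added v :=
  Finset.sum_subset D.subset_univ fun _ _ hv => σ.added_eq_zero fun h => hv (hD h)

theorem added_le (σ : Stretch G P s) (hD : s.dirty ⊆ D) (v : V) :
    σ.added v ≤ 2 * degIn G D v := by
  rcases (σ.added v).eq_zero_or_pos with h | h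
  · omega
  · have := (σ.load_add_le v h).2
    have : (dirtyNbrs G s v).card ≤ degIn G D v := degIn_mono G hD v
    omega

theorem cutLoad_add_le (σ : Stretch G P s) (hD : s.dirty ⊆ D) (v : V) :
    cutLoad G p D s v + σ.added v ≤ 2 * p * D.card + 2 * |(degIn G D v : ℝ) - p * D.card| := by
  rcases (σ.added v).eq_zero_or_pos with h | h
  · rw [h, Nat.cast_zero]
    linarith [cutLoad_le (G := G) (p := p) (D := D) (s := s) v,
      abs_nonneg ((degIn G D v : ℝ) - p * D.card)]
  · obtain ⟨hv, hload⟩ := σ.load_add_le v h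
    have hdeg : (dirtyNbrs G s v).card ≤ degIn G D v := degIn_mono G hD v
    have hle : (load G s v : ℝ) + σ.added v ≤ 2 * degIn G D v := mod_cast hload.trans (by omega)
    rw [cutLoad_of_mem hv]
    linarith [min_le_left (load G s v : ℝ) (2 * p * D.card),
      le_abs_self ((degIn G D v : ℝ) - p * D.card)]

theorem min_cutLoad_add_le (σ : Stretch G P s) (D' : Finset V) (v : V) :
    min (cutLoad G p D s v + σ.added v) (2 * p * D'.card) ≤ cutLoad G p D' σ.last v := by
  by_cases hv : v ∈ σ.last.dirty
  · rw [cutLoad_of_mem hv, cutLoad_of_mem (σ.last_dirty_subset hv), σ.load_last v hv, Nat.cast_add]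
    exact min_le_min_right _ (add_le_add_left (min_le_left _ _) _)
  · exact (min_le_right _ _).trans_eq (if_neg hv).symm

theorem phase (σ : Stretch G P s) (hG : CutBound G p Δ) (hp : 0 ≤ p) (hD : s.dirty ⊆ D)
    {S : Finset V} (hSD : S ⊆ D) (hS0 : 0 < S.card) (hS : 2 * S.card ≤ D.card)
    (htop : ∀ x ∈ S, ∀ y ∈ D \ S, cutLoad G p D s y ≤ cutLoad G p D s x)
    (hσ : ∑ v, σ.added v ≤ 2 * ∑ v ∈ S, σ.added v + P.turnsToMin) :
    Phase p (2 * Δ) D S (cutLoad G p D s) (fun v => σ.added v)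
      (fun v => |(degIn G D v : ℝ) - p * D.card|) where
  subset := hSD
  two_mul_card_le := hS
  card_pos := hS0
  top := htop
  load_nonneg := cutLoad_nonneg hp
  load_le := cutLoad_le
  added_nonneg _ := Nat.cast_nonneg _
  dev_nonneg _ := abs_nonneg _
  load_add_le v _ := σ.cutLoad_add_le hD v
  sum_dev_le := hG.sum_abs_le D D
  sum_added_le := by
    have hturn : P.turnsToMin ≤ 1 := by cases P <;> simp [Player.turnsToMin]
    rw [← σ.sum_added_eq hD] at hσ
    exact_mod_cast hσ.trans (Nat.add_le_add_left hturn _)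

end Stretch

theorem exists_gameLength_add_pot_le (hG : CutBound G p Δ) (hp : 0 < p) (hs : Stable G s)
    (P : Player) (hD : s.dirty ⊆ D) {m : ℕ} (hm : 0 < m) (hmD : 2 * m ≤ D.card) :
    ∃ (s' : State V) (P' : Player) (D' : Finset V), Stable G s' ∧ s'.dirty ⊆ D' ∧
      D'.card + m = D.card ∧
      gameLength G P s + pot (p * D'.card ^ 2) (∑ v ∈ D', cutLoad G p D' s' v) ≤
        gameLength G P' s' + pot (p * D.card ^ 2) (∑ v ∈ D, cutLoad G p D s v) +
          (26 * p * m ^ 2 + 20 * Δ + 2) := by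
  obtain ⟨S, hSD, rfl, htop⟩ := exists_top_subset (cutLoad G p D s) D (by omega : m ≤ D.card)
  obtain ⟨σ, hdisj, hσ⟩ := exists_stretch_disjoint S P s hs
  refine ⟨σ.last, σ.next, D \ S, σ.stable_last, ?_, Finset.card_sdiff_add_card_eq_card hSD, ?_⟩
  · exact Finset.subset_sdiff.2 ⟨σ.last_dirty_subset.trans hD, hdisj.symm⟩
  · have hpot := (σ.phase hG hp.le hD hSD hm hmD htop hσ).pot_add_le hp
      (Finset.sum_le_sum fun v _ => σ.min_cutLoad_add_le (D \ S) v) sum_cutLoad_le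
    have hlen : (gameLength G P s : ℝ) ≤ ∑ v ∈ D, (σ.added v : ℝ) + gameLength G σ.next σ.last := by
      exact_mod_cast (σ.sum_added_eq hD).symm ▸ σ.gameLength_le
    linarith

theorem gameLength_le_of_dirty_subset (hG : CutBound G p Δ) (hs : Stable G s) (P : Player)
    (hD : s.dirty ⊆ D) : (gameLength G P s : ℝ) ≤ 2 * (p * D.card ^ 2 + Δ) := by
  obtain ⟨σ, hdisj, -⟩ := exists_stretch_disjoint Finset.univ P s hs
  have hlast : σ.last.dirty = ∅ := top_disjoint.1 hdisj
  have hlen : gameLength G P s ≤ ∑ v ∈ D, 2 * degIn G D v := by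
    have := σ.gameLength_le
    rw [gameLength_of_dirty_eq_empty G hlast, ← σ.sum_added_eq hD] at this
    exact this.trans (Finset.sum_le_sum fun v _ => σ.added_le hD v)
  have hlen' : (gameLength G P s : ℝ) ≤ 2 * ∑ v ∈ D, (degIn G D v : ℝ) := by
    rw [← Finset.mul_sum] at hlen
    exact_mod_cast hlen
  linarith [(abs_le.1 (hG D D)).2]

theorem load_initial {v : V} (hv : v ∈ (initial G).dirty) :
    load G (initial G) v = degIn G Finset.univ v :=
  (load_stabilize G _ hv).trans (Nat.zero_add _)

theorem le_sum_cutLoad_initial (hG : CutBound G p Δ) (hp : 0 ≤ p) :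
    p * (Fintype.card V : ℝ) ^ 2 - 2 * Δ ≤ ∑ v, cutLoad G p Finset.univ (initial G) v := by
  have hle (v : V) : p * Fintype.card V - |(degIn G Finset.univ v : ℝ) - p * Fintype.card V| ≤
      cutLoad G p Finset.univ (initial G) v := by
    have hpn : 0 ≤ p * Fintype.card V := by positivity
    have habs := abs_nonneg ((degIn G Finset.univ v : ℝ) - p * Fintype.card V)
    unfold cutLoad
    rw [Finset.card_univ]
    split_ifs with hv
    · rw [load_initial hv]
      exact le_min (by linarith [neg_abs_le ((degIn G Finset.univ v : ℝ) - p * Fintype.card V)])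
        (by linarith)
    · linarith
  have hsum := Finset.sum_le_sum fun v (_ : v ∈ Finset.univ) => hle v
  have hdev := hG.sum_abs_le Finset.univ Finset.univ
  rw [Finset.sum_sub_distrib, Finset.sum_const, nsmul_eq_mul, Finset.card_univ] at hsum
  rw [Finset.card_univ] at hdev
  linarith

theorem pot_initial_le [Nonempty V] (hG : CutBound G p Δ) (hp : 0 < p) :
    pot (p * (Fintype.card V : ℝ) ^ 2) (∑ v, cutLoad G p Finset.univ (initial G) v) ≤
      p * (Fintype.card V : ℝ) ^ 2 * Real.exp (-1) + 2 * Δ := by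
  have hE : 0 < p * (Fintype.card V : ℝ) ^ 2 := by
    have := Fintype.card_pos (α := V)
    positivity
  have hle := sum_cutLoad_le (G := G) (p := p) (D := Finset.univ) (s := initial G)
  rw [Finset.card_univ] at hle
  refine (pot_anti hE (le_sum_cutLoad_initial hG hp.le) hle).trans ?_
  have hexp : Real.exp ((p * (Fintype.card V : ℝ) ^ 2 - 2 * Δ) / (p * (Fintype.card V : ℝ) ^ 2) - 2)
      ≤ Real.exp (-1) := by
    have : (p * (Fintype.card V : ℝ) ^ 2 - 2 * Δ) / (p * (Fintype.card V : ℝ) ^ 2) ≤ 1 :=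
      div_le_one_of_le₀ (by linarith [hG.nonneg]) hE.le
    exact Real.exp_le_exp.2 (by linarith)
  unfold pot
  linarith [mul_le_mul_of_nonneg_left hexp hE.le]

theorem exists_gameBrushNumber_add_pot_le (hG : CutBound G p Δ) (hp : 0 < p) {m : ℕ} (hm : 0 < m)
    (j : ℕ) (hj : (j + 1) * m ≤ Fintype.card V) :
    ∃ (s : State V) (P : Player) (D : Finset V), Stable G s ∧ s.dirty ⊆ D ∧
      D.card + j * m = Fintype.card V ∧
      gameBrushNumber G + pot (p * D.card ^ 2) (∑ v ∈ D, cutLoad G p D s v) ≤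
        gameLength G P s + pot (p * (Fintype.card V : ℝ) ^ 2)
          (∑ v, cutLoad G p Finset.univ (initial G) v) + j * (26 * p * m ^ 2 + 20 * Δ + 2) := by
  induction j with
  | zero =>
    exact ⟨initial G, .min, Finset.univ, stable_stabilize G _, Finset.subset_univ _,
      by simp [Finset.card_univ], by simp [gameBrushNumber, Finset.card_univ]⟩
  | succ j ih =>
    obtain ⟨s, P, D, hs, hsD, hcard, hlen⟩ := ih (by linarith)
    obtain ⟨s', P', D', hs', hsD', hcard', hlen'⟩ :=
      exists_gameLength_add_pot_le hG hp hs P hsD hm (by linarith)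
    refine ⟨s', P', D', hs', hsD', by linarith, ?_⟩
    push_cast
    linarith

theorem gameBrushNumber_le (hG : CutBound G p Δ) (hp : 0 < p) {m M : ℕ} (hm : 0 < m)
    (hM : 0 < M) (hmM : M * m ≤ Fintype.card V) :
    (gameBrushNumber G : ℝ) ≤ p * (Fintype.card V : ℝ) ^ 2 * Real.exp (-1) +
      M * (26 * p * m ^ 2 + 20 * Δ + 2) +
      2 * p * ((Fintype.card V : ℝ) - (M - 1) * m) ^ 2 + 4 * Δ := by
  obtain ⟨j, rfl⟩ : ∃ j, M = j + 1 := ⟨M - 1, by omega⟩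
  obtain ⟨s, P, D, hs, hsD, hcard, hlen⟩ := exists_gameBrushNumber_add_pot_le hG hp hm j hmM
  have hDm : m ≤ D.card := by linarith
  have : Nonempty V := (Finset.card_pos.1 (hm.trans_le hDm)).to_type
  have hD : (D.card : ℝ) = Fintype.card V - ((j + 1 : ℕ) - 1) * m := by
    rw [← hcard]
    push_cast
    ring
  have hend := gameLength_le_of_dirty_subset hG hs P hsD
  have hpot : 0 ≤ pot (p * D.card ^ 2) (∑ v ∈ D, cutLoad G p D s v) :=
    pot_nonneg (by have := hm.trans_le hDm; positivity)
  have herr : 0 ≤ 26 * p * m ^ 2 + 20 * Δ + 2 := by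
    have := hG.nonneg
    positivity
  rw [hD] at hend
  push_cast at hend ⊢
  linarith [pot_initial_le hG hp]

end Upper

/-! ### The lower bound -/

section Counting

theorem card_filter_not_odd_Ico_le (a b c : ℕ) :
    {i ∈ Finset.Ico a b | ¬ Odd (i + c)}.card ≤ {i ∈ Finset.Ico a b | Odd (i + c)}.card + 1 := by
  suffices {i ∈ Finset.Ico a b | ¬ Odd (i + c)}.card ≤
      {i ∈ Finset.Ico a b | Odd (i + c)}.card + (b + c) % 2 by omega
  induction b with
  | zero => simp
  | succ b ih =>
    rcases le_or_gt a b with hab | hab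
    · rw [← Finset.insert_Ico_right_eq_Ico_add_one hab, Finset.filter_insert, Finset.filter_insert]
      by_cases hodd : Odd (b + c)
      · have := Nat.odd_iff.1 hodd
        rw [if_neg (not_not.2 hodd), if_pos hodd, Finset.card_insert_of_notMem (by simp)]
        omega
      · have := Nat.not_odd_iff.1 hodd
        rw [if_pos hodd, if_neg hodd, Finset.card_insert_of_notMem (by simp)]
        omega
    · rw [Finset.Ico_eq_empty_of_le (by omega : b + 1 ≤ a), Finset.filter_empty,
        Finset.filter_empty]
      exact Nat.le_add_right _ _

variable {V : Type*} [Fintype V]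

theorem sum_card_filter_le (f : V → ℕ) (a : ℕ) :
    ∑ k ∈ Finset.Ico 0 a, ({v | f v ≤ k} : Finset V).card = ∑ v, (a - f v) := by
  refine (Finset.sum_card_bipartiteAbove_eq_sum_card_bipartiteBelow fun k v => f v ≤ k).trans ?_
  refine Finset.sum_congr rfl fun v _ => ?_
  rw [← Nat.card_Ico]
  congr 1
  ext k
  simp [Finset.bipartiteBelow]

theorem sum_card_filter_lt_le (f : V → ℕ) (a b : ℕ) :
    ∑ k ∈ Finset.Ico a b, ({v | k < f v} : Finset V).card ≤ ∑ v, (f v - a) := by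
  refine (Finset.sum_card_bipartiteAbove_eq_sum_card_bipartiteBelow fun k v => k < f v).trans_le ?_
  refine Finset.sum_le_sum fun v _ => ?_
  rw [← Nat.card_Ico]
  refine Finset.card_le_card fun k hk => ?_
  obtain ⟨hk, hlt⟩ := Finset.mem_filter.1 hk
  exact Finset.mem_Ico.2 ⟨(Finset.mem_Ico.1 hk).1, hlt⟩

end Counting

section Levels

variable {V : Type*} [DecidableEq V] {G : SimpleGraph V} {P : Player} {D : Finset V} {w : V → ℕ}

namespace GreedyPlay

variable (φ : GreedyPlay G P D w)

/-- The load of `v` before turn `i`. For a vertex that has fired, it is the load with which it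
fired. -/
def loadAt (i : ℕ) (v : V) : ℕ := loadAfter w φ.mv i v

theorem loadAt_zero (v : V) : φ.loadAt 0 v = w v := by simp [loadAt, loadAfter]

theorem loadAt_succ (i : ℕ) (v : V) :
    φ.loadAt (i + 1) v = φ.loadAt i v + if φ.mv i = v then 1 else 0 :=
  loadAfter_succ φ.mv i v

theorem loadAt_mono (v : V) : Monotone fun i => φ.loadAt i v := loadAfter_mono φ.mv v

theorem loadAt_T_of_notMem_dirty {i : ℕ} (hi : i ≤ φ.T) {v : V} (hv : v ∉ φ.dirty i) :
    φ.loadAt φ.T v = φ.loadAt i v := by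
  suffices ∀ j, i ≤ j → j ≤ φ.T → φ.loadAt j v = φ.loadAt i v from this φ.T hi le_rfl
  intro j hij
  induction j, hij using Nat.le_induction with
  | base => exact fun _ => rfl
  | succ j hij ih =>
    intro hj
    have hmv : φ.mv j ≠ v := by
      rintro rfl
      exact hv (φ.dirty_anti hij (φ.mv_mem_dirty hj))
    rw [loadAt_succ, ih (by omega), if_neg hmv, add_zero]

theorem exists_forall_dirty_le_loadAt (l : ℕ) : ∃ t, ∀ u ∈ φ.dirty t, l ≤ φ.loadAt t u :=
  ⟨φ.T, by simp [φ.dirty_T]⟩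

open Classical in
/-- The first time at which all dirty vertices have load at least `l`. -/
noncomputable def levelTime (l : ℕ) : ℕ := Nat.find (φ.exists_forall_dirty_le_loadAt l)

theorem levelTime_le_T (l : ℕ) : φ.levelTime l ≤ φ.T := by
  classical
  exact Nat.find_min' _ (by simp [φ.dirty_T])

theorem le_loadAt {l t : ℕ} (h : φ.levelTime l ≤ t) {u : V} (hu : u ∈ φ.dirty t) :
    l ≤ φ.loadAt t u := by
  classical
  exact (Nat.find_spec (φ.exists_forall_dirty_le_loadAt l) u (φ.dirty_anti h hu)).trans
    (φ.loadAt_mono u h)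

theorem levelTime_mono : Monotone φ.levelTime := fun l l' h => by
  classical
  exact Nat.find_min' _ fun u hu => h.trans (φ.le_loadAt (l := l') le_rfl hu)

theorem loadAt_mv_lt {l t : ℕ} (h : t < φ.levelTime l) (hodd : Odd (t + P.turnsToMin)) :
    φ.loadAt t (φ.mv t) < l := by
  classical
  obtain ⟨u, hu, hlt⟩ : ∃ u ∈ φ.dirty t, φ.loadAt t u < l := by
    simpa using Nat.find_min (φ.exists_forall_dirty_le_loadAt l) h
  exact (φ.loadAfter_mv_le t (h.trans_le (φ.levelTime_le_T l)) hodd u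
    (List.mem_toFinset.1 hu)).trans_lt hlt

variable [Fintype V]

theorem sum_loadAt (i : ℕ) : ∑ v, φ.loadAt i v = ∑ v, w v + i := by
  induction i with
  | zero => simp [loadAt_zero]
  | succ i ih =>
    simp only [loadAt_succ, eq_comm (a := φ.mv i)]
    rw [sum_add_ite_eq, ih, add_assoc]

/-- The number of vertices of load more than `h` before turn `t`. -/
def cardAbove (t h : ℕ) : ℕ := ({v | h < φ.loadAt t v} : Finset V).card

theorem cardAbove_le_card (t h : ℕ) : φ.cardAbove t h ≤ Fintype.card V := Finset.card_le_univ _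

theorem cardAbove_anti (t : ℕ) : Antitone (φ.cardAbove t) := fun _ _ hh =>
  Finset.card_le_card (Finset.monotone_filter_right _ fun _ _ h => hh.trans_lt h)

theorem cardAbove_succ_le (t h : ℕ) :
    φ.cardAbove (t + 1) h ≤ φ.cardAbove t h + if φ.loadAt t (φ.mv t) = h then 1 else 0 := by
  have hsub : ({v | h < φ.loadAt (t + 1) v} : Finset V) ⊆
      ({v | h < φ.loadAt t v} : Finset V) ∪ if φ.loadAt t (φ.mv t) = h then {φ.mv t} else ∅ := by
    intro v hv
    rw [Finset.mem_filter_univ, loadAt_succ] at hv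
    rw [Finset.mem_union, Finset.mem_filter_univ]
    by_cases hmv : φ.mv t = v
    · subst hmv
      rw [if_pos rfl] at hv
      split_ifs with heq
      · exact Or.inr (Finset.mem_singleton_self _)
      · exact Or.inl (by omega)
    · rw [if_neg hmv, add_zero] at hv
      exact Or.inl hv
  refine (Finset.card_le_card hsub).trans ((Finset.card_union_le _ _).trans ?_)
  unfold cardAbove
  split_ifs <;> simp

theorem cast_card_loadAt_le (t k : ℕ) :
    (({v | φ.loadAt t v ≤ k} : Finset V).card : ℝ) = Fintype.card V - φ.cardAbove t k := by
  have := Finset.card_filter_add_card_filter_not (s := (Finset.univ : Finset V))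
    (fun v => k < φ.loadAt t v)
  simp only [not_lt, Finset.card_univ] at this
  rw [← this, cardAbove]
  push_cast
  ring

/-- Every move of Max fills a unit of volume below the level `b` that was empty at the start. -/
theorem card_odd_le {t₁ t₂ a b : ℕ} (h : ∀ i ∈ Finset.Ico t₁ t₂, Odd (i + P.turnsToMin) →
      φ.loadAt i (φ.mv i) ∈ Finset.Ico a b) :
    {i ∈ Finset.Ico t₁ t₂ | Odd (i + P.turnsToMin)}.card ≤
      ∑ k ∈ Finset.Ico a b, ({v | φ.loadAt t₁ v ≤ k} : Finset V).card := by
  rw [← Finset.card_sigma]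
  refine Finset.card_le_card_of_injOn (fun i => ⟨φ.loadAt i (φ.mv i), φ.mv i⟩) ?_ ?_
  · intro i hi
    obtain ⟨hi, hodd⟩ := Finset.mem_filter.1 (Finset.mem_coe.1 hi)
    exact Finset.mem_coe.2 (Finset.mem_sigma.2 ⟨h i hi hodd,
      Finset.mem_filter_univ _ |>.2 (φ.loadAt_mono _ (Finset.mem_Ico.1 hi).1)⟩)
  · have hlt {i j : ℕ} (hij : i < j) (hmv : φ.mv i = φ.mv j) :
        φ.loadAt i (φ.mv i) < φ.loadAt j (φ.mv j) := by
      have hsucc := φ.loadAt_succ i (φ.mv i)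
      rw [if_pos rfl] at hsucc
      have : φ.loadAt (i + 1) (φ.mv i) ≤ φ.loadAt j (φ.mv i) := φ.loadAt_mono (φ.mv i) hij
      rw [← hmv]
      omega
    intro i _ j _ hij
    simp only [Sigma.mk.injEq, heq_eq_eq] at hij
    rcases lt_trichotomy i j with hlt' | heq | hlt'
    · exact absurd hij.1 (hlt hlt' hij.2).ne
    · exact heq
    · exact absurd hij.1 (hlt hlt' hij.2.symm).ne'

/-- The total height of the loads above `a`, where the vertex of `i`-th largest load counts only up
to `2 p (n - i)`, the load at which the vertex that fires `i`-th is expected to fire. -/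
noncomputable def truncHeight (p : ℝ) (t a : ℕ) : ℝ :=
  ∑ h ∈ Finset.Ico a ⌈2 * p * Fintype.card V⌉₊,
    min (φ.cardAbove t h : ℝ) (Fintype.card V - h / (2 * p))

variable {p : ℝ}

theorem truncHeight_succ_le (t a : ℕ) :
    φ.truncHeight p (t + 1) a ≤ φ.truncHeight p t a + if a ≤ φ.loadAt t (φ.mv t) then 1 else 0 := by
  have hterm (h : ℕ) : min (φ.cardAbove (t + 1) h : ℝ) (Fintype.card V - h / (2 * p)) ≤
      min (φ.cardAbove t h : ℝ) (Fintype.card V - h / (2 * p)) +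
        if φ.loadAt t (φ.mv t) = h then (1 : ℝ) else 0 := by
    have hcard : (φ.cardAbove (t + 1) h : ℝ) ≤
        φ.cardAbove t h + if φ.loadAt t (φ.mv t) = h then (1 : ℝ) else 0 :=
      mod_cast φ.cardAbove_succ_le t h
    rw [← min_add_add_right]
    exact min_le_min hcard (le_add_of_nonneg_right (by split_ifs <;> norm_num))
  refine (Finset.sum_le_sum fun h _ => hterm h).trans ?_
  rw [Finset.sum_add_distrib, Finset.sum_ite_eq, truncHeight]
  gcongr
  split_ifs with hmem hle
  · exact le_rfl
  · exact absurd (Finset.mem_Ico.1 hmem).1 hle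
  · exact zero_le_one
  · exact le_rfl

theorem truncHeight_le_add_card {t₁ t₂ a : ℕ} (ht : t₁ ≤ t₂)
    (h : ∀ i ∈ Finset.Ico t₁ t₂, Odd (i + P.turnsToMin) → φ.loadAt i (φ.mv i) < a) :
    φ.truncHeight p t₂ a ≤ φ.truncHeight p t₁ a +
      {i ∈ Finset.Ico t₁ t₂ | ¬ Odd (i + P.turnsToMin)}.card := by
  induction t₂, ht using Nat.le_induction with
  | base => simp
  | succ t ht ih =>
    have hih := ih fun i hi => h i (Finset.Ico_subset_Ico_right t.le_succ hi)
    have hstep := φ.truncHeight_succ_le (p := p) t a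
    rw [← Finset.insert_Ico_right_eq_Ico_add_one ht, Finset.filter_insert]
    by_cases hodd : Odd (t + P.turnsToMin)
    · rw [if_neg (h t (Finset.mem_Ico.2 ⟨ht, t.lt_succ_self⟩) hodd).not_ge] at hstep
      rw [if_neg (not_not.2 hodd)]
      linarith
    · rw [if_pos hodd, Finset.card_insert_of_notMem (by simp)]
      push_cast
      have : (if a ≤ φ.loadAt t (φ.mv t) then (1 : ℝ) else 0) ≤ 1 := by split_ifs <;> norm_num
      linarith

theorem truncHeight_levelTime_le {t a b : ℕ} (ht : t ≤ φ.levelTime b)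
    (h : ∀ i, t ≤ i → i < φ.levelTime b → a ≤ φ.loadAt i (φ.mv i)) :
    φ.truncHeight p (φ.levelTime b) b ≤ φ.truncHeight p t b +
      ∑ k ∈ Finset.Ico a b, (({v | φ.loadAt t v ≤ k} : Finset V).card : ℝ) + 1 := by
  have hheight := φ.truncHeight_le_add_card (p := p) ht fun i hi hodd =>
    φ.loadAt_mv_lt (Finset.mem_Ico.1 hi).2 hodd
  have hmin := card_filter_not_odd_Ico_le t (φ.levelTime b) P.turnsToMin
  have hmax := φ.card_odd_le (t₁ := t) (t₂ := φ.levelTime b) (a := a) (b := b) fun i hi hodd =>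
    have hi' := Finset.mem_Ico.1 hi
    Finset.mem_Ico.2 ⟨h i hi'.1 hi'.2, φ.loadAt_mv_lt hi'.2 hodd⟩
  have : ({i ∈ Finset.Ico t (φ.levelTime b) | ¬ Odd (i + P.turnsToMin)}.card : ℝ) ≤
      ∑ k ∈ Finset.Ico a b, (({v | φ.loadAt t v ≤ k} : Finset V).card : ℝ) + 1 :=
    mod_cast hmin.trans (Nat.add_le_add_right hmax 1)
  linarith

theorem truncHeight_levelTime_succ_le {l : ℕ} (hl : l < ⌈2 * p * Fintype.card V⌉₊) :
    φ.truncHeight p (φ.levelTime (l + 1)) (l + 1) ≤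
      φ.truncHeight p (φ.levelTime l) l + Fintype.card V + 1 -
        2 * min (φ.cardAbove (φ.levelTime l) l : ℝ) (Fintype.card V - l / (2 * p)) := by
  have hlevel := φ.truncHeight_levelTime_le (p := p) (a := l) (φ.levelTime_mono l.le_succ)
    fun i hi hlt => φ.le_loadAt hi (φ.mv_mem_dirty (hlt.trans_le (φ.levelTime_le_T _)))
  rw [Nat.succ_eq_add_one, Nat.Ico_succ_singleton, Finset.sum_singleton, cast_card_loadAt_le]
    at hlevel
  have hbot : φ.truncHeight p (φ.levelTime l) l =
      min (φ.cardAbove (φ.levelTime l) l : ℝ) (Fintype.card V - l / (2 * p)) +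
        φ.truncHeight p (φ.levelTime l) (l + 1) :=
    Finset.sum_eq_sum_Ico_succ_bot hl _
  linarith [min_le_left (φ.cardAbove (φ.levelTime l) l : ℝ) (Fintype.card V - l / (2 * p))]

end GreedyPlay

end Levels

section Capacity

theorem sum_min_le {p n j : ℝ} (hp : 0 < p) (hj : 0 ≤ j) {l H : ℕ} (hl : l ≤ H)
    (hH : (H : ℝ) ≤ 2 * p * n + 1) (hjl : 2 * p * j ≤ 2 * p * n - l + 1) :
    ∑ h ∈ Finset.Ico l H, min j (n - h / (2 * p)) ≤ j * (2 * p * n - l + 1) - p * j ^ 2 := by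
  induction hd : H - l generalizing l j with
  | zero =>
    rw [Finset.Ico_eq_empty_of_le (by omega), Finset.sum_empty]
    have := mul_nonneg hj (by linarith [mul_nonneg hp.le hj] : 0 ≤ 2 * p * n - l + 1 - p * j)
    linarith
  | succ d ih =>
    have hlH : (l : ℝ) + 1 ≤ H := by exact_mod_cast (by omega : l + 1 ≤ H)
    have hdiv : 2 * p * (l / (2 * p)) = l := mul_div_cancel₀ _ (by positivity)
    set j' := min j (n - l / (2 * p)) with hj'
    have hj'l : 2 * p * j' ≤ 2 * p * n - l := by
      have := mul_le_mul_of_nonneg_left (min_le_right j (n - l / (2 * p)))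
        (by positivity : 0 ≤ 2 * p)
      linarith
    have hj'0 : 0 ≤ j' := by
      refine le_min hj (sub_nonneg.2 ((div_le_iff₀ (by positivity)).2 ?_))
      linarith
    have htail := ih (l := l + 1) (j := j') hj'0 (by omega) (by push_cast; linarith) (by omega)
    have hmin (h : ℕ) (hh : h ∈ Finset.Ico (l + 1) H) :
        min j (n - h / (2 * p)) = min j' (n - h / (2 * p)) := by
      have hle : (l : ℝ) ≤ h := by
        exact_mod_cast (l.le_succ.trans (Finset.mem_Ico.1 hh).1)
      rw [hj', min_assoc, min_eq_right (a := n - (l : ℝ) / (2 * p)) (by gcongr)]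
    rw [Finset.sum_eq_sum_Ico_succ_bot (by omega), ← hj', Finset.sum_congr rfl hmin]
    have hmono : 0 ≤ (j - j') * (2 * p * n - l + 1 - p * (j + j')) := by
      have hle : j' ≤ j := min_le_left _ _
      exact mul_nonneg (by linarith) (by linarith [mul_le_mul_of_nonneg_left hle hp.le])
    push_cast at htail
    linarith

variable {V : Type*} [Fintype V] [DecidableEq V] {G : SimpleGraph V} {P : Player} {p Δ : ℝ}

namespace GreedyPlay

theorem truncHeight_le {D : Finset V} {w : V → ℕ} (φ : GreedyPlay G P D w) (hp : 0 < p) {t l : ℕ}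
    (hl : l < ⌈2 * p * Fintype.card V⌉₊) {j : ℝ}
    (hj : j = min (φ.cardAbove t l : ℝ) (Fintype.card V - l / (2 * p))) :
    φ.truncHeight p t l ≤ j * (2 * p * Fintype.card V - l) - p * j ^ 2 + Fintype.card V := by
  have hcap : (l : ℝ) / (2 * p) ≤ Fintype.card V := by
    rw [div_le_iff₀ (by positivity)]
    linarith [Nat.lt_ceil.1 hl]
  have hj0 : 0 ≤ j := hj ▸ le_min (Nat.cast_nonneg _) (sub_nonneg.2 hcap)
  have hjn : j ≤ Fintype.card V :=
    hj ▸ (min_le_left _ _).trans (mod_cast φ.cardAbove_le_card t l)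
  have hjl : 2 * p * j ≤ 2 * p * Fintype.card V - l := by
    have : j ≤ Fintype.card V - l / (2 * p) := hj ▸ min_le_right _ _
    rw [le_sub_iff_add_le, ← le_sub_iff_add_le', div_le_iff₀ (by positivity)] at this
    linarith
  have hsum : φ.truncHeight p t l ≤ ∑ h ∈ Finset.Ico l ⌈2 * p * Fintype.card V⌉₊,
      min j (Fintype.card V - h / (2 * p)) := by
    refine Finset.sum_le_sum fun h hh => le_min ?_ (min_le_right _ _)
    have hle := (Finset.mem_Ico.1 hh).1
    rw [hj]
    refine min_le_min (mod_cast φ.cardAbove_anti t hle) ?_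
    gcongr
  linarith [sum_min_le hp hj0 hl.le (Nat.ceil_lt_add_one (by positivity)).le (by linarith)]

variable {D : Finset V} (φ : GreedyPlay G P D (degIn G Finset.univ))

theorem sum_card_loadAt_zero_le (hG : CutBound G p Δ) (hp : 0 ≤ p) :
    ∑ k ∈ Finset.Ico 0 ⌈p * Fintype.card V⌉₊, (({v | φ.loadAt 0 v ≤ k} : Finset V).card : ℝ) ≤
      2 * Δ + Fintype.card V := by
  set a := ⌈p * Fintype.card V⌉₊
  have ha : (a : ℝ) ≤ p * Fintype.card V + 1 := (Nat.ceil_lt_add_one (by positivity)).le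
  have hsum : ∑ k ∈ Finset.Ico 0 a, (({v | φ.loadAt 0 v ≤ k} : Finset V).card : ℝ) =
      ∑ v, ((a - degIn G Finset.univ v : ℕ) : ℝ) := by
    simp only [φ.loadAt_zero]
    exact_mod_cast sum_card_filter_le (degIn G Finset.univ) a
  have hdev := hG.sum_abs_le Finset.univ Finset.univ
  rw [Finset.card_univ] at hdev
  calc _ ≤ ∑ v, (|(degIn G Finset.univ v : ℝ) - p * Fintype.card V| + 1) := by
        rw [hsum]
        refine Finset.sum_le_sum fun v _ => ?_
        rcases le_total (degIn G Finset.univ v) a with hle | hle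
        · rw [Nat.cast_sub hle]
          linarith [neg_abs_le ((degIn G Finset.univ v : ℝ) - p * Fintype.card V)]
        · rw [Nat.sub_eq_zero_of_le hle, Nat.cast_zero]
          positivity
    _ ≤ _ := by
        rw [Finset.sum_add_distrib, Finset.sum_const, Finset.card_univ, nsmul_eq_mul, mul_one]
        linarith

theorem truncHeight_zero_le (hG : CutBound G p Δ) :
    φ.truncHeight p 0 ⌈p * Fintype.card V⌉₊ ≤ 2 * Δ := by
  set a := ⌈p * Fintype.card V⌉₊
  have ha : p * Fintype.card V ≤ a := Nat.le_ceil _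
  have hdev := hG.sum_abs_le Finset.univ Finset.univ
  rw [Finset.card_univ] at hdev
  calc φ.truncHeight p 0 a
      ≤ ∑ k ∈ Finset.Ico a ⌈2 * p * Fintype.card V⌉₊, (φ.cardAbove 0 k : ℝ) :=
        Finset.sum_le_sum fun k _ => min_le_left _ _
    _ ≤ ∑ v, ((degIn G Finset.univ v - a : ℕ) : ℝ) := by
        simp only [cardAbove, φ.loadAt_zero]
        exact_mod_cast sum_card_filter_lt_le (degIn G Finset.univ) a _
    _ ≤ ∑ v, |(degIn G Finset.univ v : ℝ) - p * Fintype.card V| := by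
        refine Finset.sum_le_sum fun v _ => ?_
        rcases le_total a (degIn G Finset.univ v) with hle | hle
        · rw [Nat.cast_sub hle]
          linarith [le_abs_self ((degIn G Finset.univ v : ℝ) - p * Fintype.card V)]
        · rw [Nat.sub_eq_zero_of_le hle, Nat.cast_zero]
          exact abs_nonneg _
    _ ≤ _ := hdev

theorem truncHeight_levelTime_ceil_le (hG : CutBound G p Δ) (hp : 0 ≤ p) :
    φ.truncHeight p (φ.levelTime ⌈p * Fintype.card V⌉₊) ⌈p * Fintype.card V⌉₊ ≤
      4 * Δ + Fintype.card V + 1 := by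
  have hlevel := φ.truncHeight_levelTime_le (p := p) (t := 0) (a := 0)
    (b := ⌈p * Fintype.card V⌉₊) (Nat.zero_le _) fun _ _ _ => Nat.zero_le _
  linarith [φ.sum_card_loadAt_zero_le hG hp, φ.truncHeight_zero_le hG]

end GreedyPlay

end Capacity

section Curve

open Real Set

/-- The least load, relative to the average degree, at the time when a fraction `κ` of the vertices
is dirty in the limiting game. -/
noncomputable def levelCurve (κ : ℝ) : ℝ := κ * (1 - 2 * log κ)

/-- The truncated height, relative to the sum of all degrees, at the time when a fraction `κ` of the
vertices is dirty in the limiting game. -/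
noncomputable def heightCurve (κ : ℝ) : ℝ := (1 - κ) * (1 + κ - levelCurve κ)

theorem hasDerivAt_levelCurve {κ : ℝ} (hκ : 0 < κ) :
    HasDerivAt levelCurve (-1 - 2 * log κ) κ := by
  have hlog : HasDerivAt (fun x : ℝ => 1 - 2 * log x) (-(2 * κ⁻¹)) κ :=
    ((hasDerivAt_log hκ.ne').const_mul 2).const_sub 1
  refine ((hasDerivAt_id κ).mul hlog).congr_deriv ?_
  simp only [id]
  field_simp
  ring

theorem levelCurve_one : levelCurve 1 = 1 := by simp [levelCurve]

theorem neg_half_lt_log {κ : ℝ} (hκ : exp (-(1 / 2)) < κ) : -(1 / 2) < log κ :=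
  (lt_log_iff_exp_lt ((exp_pos _).trans hκ)).2 hκ

theorem half_lt_of_exp_lt {κ : ℝ} (hκ : exp (-(1 / 2)) < κ) : 1 / 2 < κ := by
  linarith [add_one_le_exp (-(1 / 2) : ℝ)]

theorem continuousOn_levelCurve {a : ℝ} (ha : 0 < a) : ContinuousOn levelCurve (Icc a 1) :=
  fun _ hx => (hasDerivAt_levelCurve (ha.trans_le hx.1)).continuousAt.continuousWithinAt

theorem strictAntiOn_levelCurve {a : ℝ} (ha : exp (-(1 / 2)) < a) :
    StrictAntiOn levelCurve (Icc a 1) := by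
  have ha0 := (exp_pos _).trans ha
  refine strictAntiOn_of_deriv_neg (convex_Icc a 1) (continuousOn_levelCurve ha0) fun x hx => ?_
  rw [interior_Icc] at hx
  rw [(hasDerivAt_levelCurve (ha0.trans hx.1)).deriv]
  linarith [neg_half_lt_log (ha.trans hx.1)]

theorem levelCurve_lt_two_mul {κ : ℝ} (hκ : exp (-(1 / 2)) < κ) : levelCurve κ < 2 * κ := by
  have hlog : 1 - 2 * log κ < 2 := by linarith [neg_half_lt_log hκ]
  rw [levelCurve, mul_comm 2 κ]
  exact mul_lt_mul_of_pos_left hlog ((exp_pos _).trans hκ)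

theorem heightCurve_nonneg {κ : ℝ} (hκ : 1 / 2 ≤ κ) (hκ1 : κ ≤ 1) : 0 ≤ heightCurve κ := by
  have hκ0 : 0 < κ := by linarith
  have hlog : κ - 1 ≤ κ * log κ := by
    calc κ - 1 = κ * (1 - κ⁻¹) := by field_simp
      _ ≤ κ * log κ := mul_le_mul_of_nonneg_left (one_sub_inv_le_log_of_pos hκ0) hκ0.le
  unfold heightCurve levelCurve
  exact mul_nonneg (by linarith) (by linarith)

theorem levelCurve_sub_mul_le_heightCurve_sub {κ κ' : ℝ} (hκ' : exp (-(1 / 2)) < κ') (hle : κ' ≤ κ)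
    (hκ1 : κ ≤ 1) :
    (levelCurve κ' - levelCurve κ) * (2 * κ' - 1) ≤ heightCurve κ' - heightCurve κ := by
  have hκ'0 := (exp_pos _).trans hκ'
  have hderiv (x : ℝ) (hx : 0 < x) :
      HasDerivAt (fun x => heightCurve x - levelCurve x * (2 * κ' - 1))
        ((-1 - 2 * log x) * (2 * (x - κ'))) x := by
    have hlevel := hasDerivAt_levelCurve hx
    refine ((((hasDerivAt_id x).const_sub 1).mul (((hasDerivAt_id x).const_add 1).sub hlevel)).sub
      (hlevel.mul_const (2 * κ' - 1))).congr_deriv ?_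
    simp only [levelCurve, id, Pi.sub_apply]
    ring
  have hanti : AntitoneOn (fun x => heightCurve x - levelCurve x * (2 * κ' - 1)) (Icc κ' 1) := by
    refine antitoneOn_of_deriv_nonpos (convex_Icc κ' 1)
      (fun x hx => (hderiv x (hκ'0.trans_le hx.1)).continuousAt.continuousWithinAt)
      (fun x hx => ?_) fun x hx => ?_
    · rw [interior_Icc] at hx
      exact (hderiv x (hκ'0.trans hx.1)).differentiableAt.differentiableWithinAt
    · rw [interior_Icc] at hx
      rw [(hderiv x (hκ'0.trans hx.1)).deriv]
      exact mul_nonpos_of_nonpos_of_nonneg (by linarith [neg_half_lt_log (hκ'.trans hx.1)])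
        (by linarith [hx.1])
  have := hanti (left_mem_Icc.2 (hle.trans hκ1)) ⟨hle, hκ1⟩ hle
  linarith

theorem sq_sub_heightCurve (κ : ℝ) :
    (1 - levelCurve κ / 2) ^ 2 - heightCurve κ = (κ - levelCurve κ / 2) ^ 2 := by
  unfold heightCurve
  ring

theorem sq_sub_levelCurve_le {κ₁ κ : ℝ} (hκ₁ : exp (-(1 / 2)) < κ₁) (hκ : κ ∈ Icc κ₁ 1) :
    (κ₁ - levelCurve κ₁ / 2) ^ 2 ≤ (1 - levelCurve κ / 2) ^ 2 - heightCurve κ := by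
  have hle : levelCurve κ ≤ levelCurve κ₁ :=
    (strictAntiOn_levelCurve hκ₁).antitoneOn ⟨le_rfl, hκ.1.trans hκ.2⟩ hκ hκ.1
  have hlt := levelCurve_lt_two_mul hκ₁
  rw [sq_sub_heightCurve]
  exact pow_le_pow_left₀ (by linarith) (by linarith [hκ.1]) 2

variable {κ₁ q : ℝ}

theorem exists_levelCurve_mul_eq (hκ₁ : exp (-(1 / 2)) < κ₁) (hκ₁' : κ₁ ≤ 1) (hq : 0 < q) {l : ℝ}
    (hl : q ≤ l) (hl' : l ≤ levelCurve κ₁ * q) : ∃ κ ∈ Icc κ₁ 1, levelCurve κ * q = l := by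
  obtain ⟨κ, hκ, heq⟩ : l / q ∈ levelCurve '' Icc κ₁ 1 := by
    refine intermediate_value_Icc' hκ₁' (continuousOn_levelCurve ((exp_pos _).trans hκ₁)) ⟨?_, ?_⟩
    · rwa [levelCurve_one, one_le_div hq]
    · rwa [div_le_iff₀ hq]
  exact ⟨κ, hκ, by rw [heq, div_mul_cancel₀ _ hq.ne']⟩

theorem two_mul_sub_one_le_heightCurve_sub (hκ₁ : exp (-(1 / 2)) < κ₁) (hq : 0 < q) {κ κ' l : ℝ}
    (hκ : κ ∈ Icc κ₁ 1) (hκ' : κ' ∈ Icc κ₁ 1) (hl : levelCurve κ * q = l)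
    (hl' : levelCurve κ' * q = l + 1) :
    2 * κ' - 1 ≤ q * (heightCurve κ' - heightCurve κ) := by
  have hle : κ' ≤ κ := by
    refine ((strictAntiOn_levelCurve hκ₁).lt_iff_gt hκ hκ').1 ?_ |>.le
    refine lt_of_mul_lt_mul_right (a := q) ?_ hq.le
    rw [hl, hl']
    exact lt_add_one l
  calc 2 * κ' - 1 = q * ((levelCurve κ' - levelCurve κ) * (2 * κ' - 1)) := by
        linear_combination -(2 * κ' - 1) * (hl' - hl)
    _ ≤ q * (heightCurve κ' - heightCurve κ) := by
        gcongr
        exact levelCurve_sub_mul_le_heightCurve_sub (hκ₁.trans_le hκ'.1) hle hκ.2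

end Curve

section LayerCake

theorem sub_le_card_filter_lt {y z : ℝ} (hyz : y ≤ z) (l : ℕ) :
    y - l ≤ ({h ∈ Finset.Ico l ⌈z⌉₊ | ((h : ℕ) : ℝ) < y}.card : ℝ) := by
  have hsub : Finset.Ico l ⌈y⌉₊ ⊆ {h ∈ Finset.Ico l ⌈z⌉₊ | ((h : ℕ) : ℝ) < y} := fun h hh => by
    obtain ⟨hlh, hhy⟩ := Finset.mem_Ico.1 hh
    exact Finset.mem_filter.2
      ⟨Finset.mem_Ico.2 ⟨hlh, hhy.trans_le (Nat.ceil_le_ceil hyz)⟩, Nat.lt_ceil.1 hhy⟩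
  calc y - l ≤ ⌈y⌉₊ - l := by linarith [Nat.le_ceil y]
    _ ≤ ((⌈y⌉₊ - l : ℕ) : ℝ) := by
        rw [sub_le_iff_le_add]
        exact mod_cast le_tsub_add
    _ ≤ _ := by
        rw [← Nat.card_Ico]
        exact mod_cast Finset.card_le_card hsub

theorem sum_sub_le_sum_card_filter_lt {ι : Type*} (A : Finset ι) {y : ι → ℝ} {z : ℝ}
    (hyz : ∀ v ∈ A, y v ≤ z) (l : ℕ) :
    ∑ v ∈ A, (y v - l) ≤ ∑ h ∈ Finset.Ico l ⌈z⌉₊, ({v ∈ A | ((h : ℕ) : ℝ) < y v}.card : ℝ) := by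
  have hswap : ∑ h ∈ Finset.Ico l ⌈z⌉₊, {v ∈ A | ((h : ℕ) : ℝ) < y v}.card =
      ∑ v ∈ A, {h ∈ Finset.Ico l ⌈z⌉₊ | ((h : ℕ) : ℝ) < y v}.card :=
    Finset.sum_card_bipartiteAbove_eq_sum_card_bipartiteBelow fun (h : ℕ) v => (h : ℝ) < y v
  rw [← Nat.cast_sum, hswap, Nat.cast_sum]
  exact Finset.sum_le_sum fun v hv => sub_le_card_filter_lt (hyz v hv) l

end LayerCake

section FirstPositions

theorem filter_range_lt {j n : ℕ} (hj : j ≤ n) : {i ∈ Finset.range n | i < j} = Finset.range j := by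
  ext i
  simp only [Finset.mem_filter, Finset.mem_range]
  omega

variable {V : Type*} [Fintype V] {n : ℕ} (e : V ≃ Fin n) {j : ℕ}

theorem card_filter_lt_equiv_fin (hj : j ≤ n) : ({v | (e v : ℕ) < j} : Finset V).card = j := by
  rw [card_filter_equiv_fin e (· < j), filter_range_lt hj, Finset.card_range]

theorem mul_sub_sq_le_sum_filter_lt {p : ℝ} (hp : 0 ≤ p) (hj : j ≤ n) :
    2 * p * n * j - p * j ^ 2 ≤ ∑ v with (e v : ℕ) < j, 2 * p * (n - e v) := by
  rw [sum_filter_equiv_fin e (· < j) fun i => 2 * p * (n - i), filter_range_lt hj]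
  clear hj
  induction j with
  | zero => simp
  | succ j ih =>
    rw [Finset.sum_range_succ]
    push_cast
    linarith

theorem card_filter_lt_mul_sub_le {p : ℝ} (hp : 0 < p) {x : ℝ} (hx0 : 0 ≤ x)
    (hx : x ≤ 2 * p * n) :
    (({v | x < 2 * p * (n - e v - 1)} : Finset V).card : ℝ) ≤ n - x / (2 * p) := by
  have hnn : 0 ≤ n - x / (2 * p) := by
    rw [sub_nonneg, div_le_iff₀ (by positivity)]
    linarith
  have hsub : ({v | x < 2 * p * (n - e v - 1)} : Finset V) ⊆
      ({v | (e v : ℕ) < ⌊n - x / (2 * p)⌋₊} : Finset V) := fun v hv => by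
    have hlt := (Finset.mem_filter_univ _).1 hv
    rw [Finset.mem_filter_univ, ← Nat.succ_le_iff, Nat.le_floor_iff hnn, le_sub_iff_add_le,
      ← le_sub_iff_add_le', div_le_iff₀ (by positivity)]
    push_cast
    linarith
  have hfloor : ⌊n - x / (2 * p)⌋₊ ≤ n :=
    Nat.floor_le_of_le (sub_le_self _ (by positivity))
  refine (Nat.cast_le.2 (Finset.card_le_card hsub)).trans ?_
  rw [card_filter_lt_equiv_fin e hfloor]
  exact Nat.floor_le hnn

end FirstPositions

section Lower

variable {V : Type*} [Fintype V] [DecidableEq V] {G : SimpleGraph V} {P : Player} {p Δ : ℝ}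

namespace GreedyPlay

section Height

variable {D : Finset V}

theorem truncHeight_levelTime_succ_le_max {w : V → ℕ} (φ : GreedyPlay G P D w) (hp : 0 < p) {l : ℕ}
    {κ : ℝ} (hκ : Real.exp (-(1 / 2)) < κ) (hκ1 : κ ≤ 1)
    (hl : levelCurve κ * (p * Fintype.card V) = l) (hn : 0 < Fintype.card V) :
    φ.truncHeight p (φ.levelTime (l + 1)) (l + 1) ≤
      max (p * Fintype.card V ^ 2 * heightCurve κ + 2 * Fintype.card V + 1)
        (φ.truncHeight p (φ.levelTime l) l + Fintype.card V * (2 * κ - 1) + 1) := by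
  set n : ℝ := (Fintype.card V : ℝ)
  have hn0 : 0 < n := Nat.cast_pos.2 hn
  have hlκ : (l : ℝ) < 2 * κ * (p * n) := by
    rw [← hl]
    gcongr
    exact levelCurve_lt_two_mul hκ
  have hl2 : (l : ℝ) < 2 * p * n := by
    have : 2 * κ * (p * n) ≤ 2 * 1 * (p * n) := by gcongr
    linarith
  have hceil : l < ⌈2 * p * n⌉₊ := Nat.lt_ceil.2 hl2
  have hstep := φ.truncHeight_levelTime_succ_le (p := p) hceil
  have hcap := φ.truncHeight_le hp (t := φ.levelTime l) hceil rfl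
  set j : ℝ := min (φ.cardAbove (φ.levelTime l) l : ℝ) (n - l / (2 * p))
  rcases le_or_gt (n * (1 - κ)) j with hj | hj
  · exact le_max_of_le_right (by linarith)
  · have hj0 : 0 ≤ j := by
      refine le_min (Nat.cast_nonneg _) (sub_nonneg.2 ?_)
      rw [div_le_iff₀ (by positivity)]
      linarith
    have hquad : p * n ^ 2 * heightCurve κ =
        n * (1 - κ) * (2 * p * n - l) - p * (n * (1 - κ)) ^ 2 := by
      rw [← hl, heightCurve]
      ring
    have hmono : 0 ≤ (n * (1 - κ) - j) * (2 * p * n - l - p * (n * (1 - κ) + j)) := by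
      have := mul_le_mul_of_nonneg_left hj.le hp.le
      exact mul_nonneg (by linarith) (by linarith)
    exact le_max_of_le_left (by linarith)

variable (φ : GreedyPlay G P D (degIn G Finset.univ))

theorem exists_truncHeight_le_heightCurve (hG : CutBound G p Δ) (hp : 0 < p)
    (hn : 0 < Fintype.card V) {κ₁ : ℝ} (hκ₁ : Real.exp (-(1 / 2)) < κ₁) (hκ₁' : κ₁ ≤ 1) {l : ℕ}
    (hl : ⌈p * Fintype.card V⌉₊ ≤ l) (hl' : l ≤ levelCurve κ₁ * (p * Fintype.card V)) :
    ∃ κ ∈ Set.Icc κ₁ 1, levelCurve κ * (p * Fintype.card V) = l ∧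
      φ.truncHeight p (φ.levelTime l) l ≤ p * Fintype.card V ^ 2 * heightCurve κ + 4 * Δ +
        2 * Fintype.card V + 1 + (l - p * Fintype.card V) + 2 * Fintype.card V * (1 - κ) := by
  set n : ℝ := (Fintype.card V : ℝ)
  have hn0 : 0 < n := Nat.cast_pos.2 hn
  have hpn : 0 < p * n := by positivity
  have hΔ := hG.nonneg
  have hpl {l : ℕ} (hl : ⌈p * n⌉₊ ≤ l) : p * n ≤ l := Nat.ceil_le.1 hl
  induction l, hl using Nat.le_induction with
  | base =>
    obtain ⟨κ, hκ, heq⟩ := exists_levelCurve_mul_eq hκ₁ hκ₁' hpn (hpl le_rfl) hl'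
    refine ⟨κ, hκ, heq, (φ.truncHeight_levelTime_ceil_le hG hp.le).trans ?_⟩
    have hheight := heightCurve_nonneg ((half_lt_of_exp_lt hκ₁).le.trans hκ.1) hκ.2
    have : 0 ≤ p * n ^ 2 * heightCurve κ := by positivity
    have : 0 ≤ 2 * n * (1 - κ) := mul_nonneg (by positivity) (by linarith [hκ.2])
    linarith [hpl le_rfl]
  | succ l hl ih =>
    push_cast at hl'
    obtain ⟨κ, hκ, heq, hle⟩ := ih (by linarith)
    obtain ⟨κ', hκ', heq'⟩ :=
      exists_levelCurve_mul_eq hκ₁ hκ₁' hpn (by linarith [hpl hl] : p * n ≤ l + 1) hl'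
    refine ⟨κ', hκ', mod_cast heq', ?_⟩
    have hcurve : n * (2 * κ' - 1) ≤
        p * n ^ 2 * heightCurve κ' - p * n ^ 2 * heightCurve κ := by
      calc _ ≤ n * (p * n * (heightCurve κ' - heightCurve κ)) := by
            gcongr
            exact two_mul_sub_one_le_heightCurve_sub hκ₁ hpn hκ hκ' heq heq'
        _ = _ := by ring
    have hhalf : 0 ≤ n * (2 * κ' - 1) :=
      mul_nonneg hn0.le (by linarith [half_lt_of_exp_lt (hκ₁.trans_le hκ'.1)])
    have hκ'1 : 0 ≤ 2 * n * (1 - κ') := mul_nonneg (by positivity) (by linarith [hκ'.2])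
    refine (φ.truncHeight_levelTime_succ_le_max hp (hκ₁.trans_le hκ.1) hκ.2 heq hn).trans ?_
    push_cast
    exact max_le (by linarith [hpl hl]) (by linarith)

end Height

variable (φ : GreedyPlay G P Finset.univ (degIn G Finset.univ))

/-- The total deviation of the numbers `φ.later v` from their expectations when each edge is present
with probability `p`. -/
noncomputable def laterDeviation (p : ℝ) : ℝ :=
  ∑ v, |(φ.later v : ℝ) - p * (Fintype.card V - φ.pos v)|

theorem sum_abs_later_le_laterDeviation (A : Finset V) :
    ∑ v ∈ A, |(φ.later v : ℝ) - p * (Fintype.card V - φ.pos v)| ≤ φ.laterDeviation p :=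
  Finset.sum_le_sum_of_subset_of_nonneg (Finset.subset_univ _) fun _ _ _ => abs_nonneg _

theorem sum_min_later_le_truncHeight (hp : 0 < p) {t l : ℕ} (ht : t ≤ φ.T) {A : Finset V}
    (hA : Disjoint A (φ.dirty t)) :
    ∑ v ∈ A, (min (2 * φ.later v : ℝ) (2 * p * (Fintype.card V - φ.pos v - 1)) - l) ≤
      φ.truncHeight p t l := by
  have hle (v : V) (_ : v ∈ A) : min (2 * φ.later v : ℝ) (2 * p * (Fintype.card V - φ.pos v - 1)) ≤
      2 * p * Fintype.card V := by
    refine (min_le_right _ _).trans (mul_le_mul_of_nonneg_left ?_ (by positivity))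
    linarith [Nat.cast_nonneg (α := ℝ) (φ.pos v : ℕ)]
  refine (sum_sub_le_sum_card_filter_lt A hle l).trans (Finset.sum_le_sum fun h hh => le_min ?_ ?_)
  · refine Nat.cast_le.2 (Finset.card_le_card fun v hv => ?_)
    obtain ⟨hvA, hlt⟩ := Finset.mem_filter.1 hv
    have hlater : h < 2 * φ.later v := mod_cast hlt.trans_le (min_le_left _ _)
    refine (Finset.mem_filter_univ _).2 (hlater.trans_le ?_)
    rw [← φ.loadAt_T_of_notMem_dirty ht (Finset.disjoint_left.1 hA hvA)]
    exact φ.two_mul_later_le v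
  · refine le_trans (Nat.cast_le.2 (Finset.card_le_card ?_)) (card_filter_lt_mul_sub_le φ.pos hp
      h.cast_nonneg (Nat.lt_ceil.1 (Finset.mem_Ico.1 hh).2).le)
    exact fun v hv => (Finset.mem_filter_univ v).2
      ((Finset.mem_filter.1 hv).2.trans_le (min_le_right _ _))

theorem le_truncHeight (hp : 0 < p) {t l j : ℕ} (ht : t ≤ φ.T)
    (hj : j + (φ.dirty t).card ≤ Fintype.card V) :
    2 * p * Fintype.card V * j - p * j ^ 2 - l * j - 2 * p * j - 2 * φ.laterDeviation p ≤
      φ.truncHeight p t l := by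
  have hjn : j ≤ Fintype.card V := by omega
  set A : Finset V := {v | (φ.pos v : ℕ) < j}
  have hclean : Disjoint A (φ.dirty t) := Finset.disjoint_left.2 fun v hv hdirty => by
    have := (Finset.mem_filter_univ _).1 hv
    have := φ.mem_dirty_iff.1 hdirty
    omega
  have hterm (v : V) (_ : v ∈ A) : 2 * p * (Fintype.card V - φ.pos v) -
      2 * |(φ.later v : ℝ) - p * (Fintype.card V - φ.pos v)| - (2 * p + l) ≤
        min (2 * φ.later v : ℝ) (2 * p * (Fintype.card V - φ.pos v - 1)) - l := by
    have hneg := neg_abs_le ((φ.later v : ℝ) - p * (Fintype.card V - φ.pos v))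
    have hnn := abs_nonneg ((φ.later v : ℝ) - p * (Fintype.card V - φ.pos v))
    rw [← sub_sub, sub_le_sub_iff_right]
    exact le_min (by linarith) (by linarith)
  refine le_trans ?_ ((Finset.sum_le_sum hterm).trans
    (φ.sum_min_later_le_truncHeight hp ht hclean))
  rw [Finset.sum_sub_distrib, Finset.sum_sub_distrib, Finset.sum_const, nsmul_eq_mul,
    ← Finset.mul_sum _ (fun v => |_|), card_filter_lt_equiv_fin φ.pos hjn]
  linarith [mul_sub_sq_le_sum_filter_lt φ.pos hp.le hjn,
    φ.sum_abs_later_le_laterDeviation (p := p) A]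

theorem le_T (hG : CutBound G p Δ) (hp : 0 < p) {l j : ℕ} (hjn : j ≤ Fintype.card V)
    (hj : Fintype.card V ≤ j + (φ.dirty (φ.levelTime l)).card) :
    2 * p * Fintype.card V * j - p * j ^ 2 - l * j + l * Fintype.card V -
      p * Fintype.card V ^ 2 - Δ - 2 * φ.laterDeviation p ≤ φ.T := by
  set A : Finset V := {v | (φ.pos v : ℕ) < j} with hA
  have hsum : ∑ v, (φ.loadAt φ.T v : ℝ) = ∑ v, (degIn G Finset.univ v : ℝ) + φ.T :=
    mod_cast φ.sum_loadAt φ.T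
  have hdeg := (abs_le.1 (hG Finset.univ Finset.univ)).2
  rw [Finset.card_univ] at hdeg
  have hfirst : ∑ v ∈ A, (2 * p * (Fintype.card V - φ.pos v) -
      2 * |(φ.later v : ℝ) - p * (Fintype.card V - φ.pos v)|) ≤
        ∑ v ∈ A, (φ.loadAt φ.T v : ℝ) := by
    refine Finset.sum_le_sum fun v _ => ?_
    have hlater : (2 * φ.later v : ℝ) ≤ φ.loadAt φ.T v := mod_cast φ.two_mul_later_le v
    linarith [neg_abs_le ((φ.later v : ℝ) - p * (Fintype.card V - φ.pos v))]
  have hlast : (Aᶜ.card : ℝ) * l ≤ ∑ v ∈ Aᶜ, (φ.loadAt φ.T v : ℝ) := by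
    rw [← nsmul_eq_mul]
    refine Finset.card_nsmul_le_sum _ _ _ fun v hv => ?_
    have hjv : j ≤ φ.pos v := by simpa [hA] using hv
    have hdirty : v ∈ φ.dirty (φ.levelTime l) := φ.mem_dirty_iff.2 (by omega)
    exact mod_cast (φ.le_loadAt le_rfl hdirty).trans (φ.loadAt_mono v (φ.levelTime_le_T l))
  rw [Finset.card_compl, hA, card_filter_lt_equiv_fin φ.pos hjn, Nat.cast_sub hjn, ← hA] at hlast
  rw [Finset.sum_sub_distrib, ← Finset.mul_sum _ (fun v => |_|)] at hfirst
  linarith [mul_sub_sq_le_sum_filter_lt φ.pos hp.le hjn, Finset.sum_add_sum_compl A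
    fun v => (φ.loadAt φ.T v : ℝ), φ.sum_abs_later_le_laterDeviation (p := p) A]

theorem sub_le_mul_floor_sub {x : ℝ} (hp : 0 ≤ p) (hx : 0 ≤ x) :
    p * x ^ 2 - p ≤ 2 * p * x * ⌊x⌋₊ - p * (⌊x⌋₊ : ℝ) ^ 2 := by
  have hfloor := Nat.floor_le hx
  have hsq : (x - ⌊x⌋₊) ^ 2 ≤ 1 :=
    pow_le_one₀ (by linarith) (by linarith [Nat.lt_floor_add_one x])
  linarith [mul_le_mul_of_nonneg_left hsq hp]

theorem card_le_floor_add_card_dirty (hG : CutBound G p Δ) (hp : 0 < p) (hn : 0 < Fintype.card V)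
    {κ : ℝ} (hκ : Real.exp (-(1 / 2)) < κ) (hκ1 : κ ≤ 1) {l : ℕ} (hl : ⌈p * Fintype.card V⌉₊ ≤ l)
    (hl' : l ≤ levelCurve κ * (p * Fintype.card V))
    (herr : 4 * Δ + 4 * Fintype.card V + 4 * p * Fintype.card V + p + 1 +
      2 * φ.laterDeviation p < p * Fintype.card V ^ 2 * (κ - levelCurve κ / 2) ^ 2) :
    Fintype.card V ≤
      ⌊Fintype.card V - l / (2 * p)⌋₊ + (φ.dirty (φ.levelTime l)).card := by
  by_contra! hlt
  obtain ⟨κ', hκ', heq, hheight⟩ := φ.exists_truncHeight_le_heightCurve hG hp hn hκ hκ1 hl hl'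
  have hclean := φ.le_truncHeight hp (l := l) (φ.levelTime_le_T l) hlt.le
  set n : ℝ := (Fintype.card V : ℝ)
  have hn0 : 0 < n := Nat.cast_pos.2 hn
  set x : ℝ := n * (1 - levelCurve κ' / 2) with hx
  have hxl : n - l / (2 * p) = x := by
    rw [hx, ← heq]
    field_simp
  rw [hxl] at hclean
  have hκ'2 := levelCurve_lt_two_mul (hκ.trans_le hκ'.1)
  have hx0 : 0 ≤ x := mul_nonneg hn0.le (by linarith [hκ'.2])
  have hxn : x ≤ n := hxl ▸ sub_le_self _ (by positivity)
  have hfloor := sub_le_mul_floor_sub hp.le hx0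
  have hgap : p * n ^ 2 * (κ - levelCurve κ / 2) ^ 2 ≤ p * x ^ 2 - p * n ^ 2 * heightCurve κ' := by
    calc _ ≤ p * n ^ 2 * ((1 - levelCurve κ' / 2) ^ 2 - heightCurve κ') := by
          gcongr
          exact sq_sub_levelCurve_le hκ hκ'
      _ = _ := by
          rw [hx]
          ring
  have hpj : 2 * p * ⌊x⌋₊ ≤ 2 * p * n := by
    gcongr
    exact (Nat.floor_le hx0).trans hxn
  have hκ'n : 2 * n * (1 - κ') ≤ 2 * n * 1 := by
    gcongr
    linarith [half_lt_of_exp_lt (hκ.trans_le hκ'.1)]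
  have hl2 : (l : ℝ) = 2 * p * (n - x) := by
    rw [← hxl]
    field_simp
    ring
  have hpx : 0 ≤ p * x := by positivity
  have hlj : (l : ℝ) * ⌊x⌋₊ = 2 * p * (n - x) * ⌊x⌋₊ := by rw [hl2]
  linarith

theorem sq_div_sub_le_T (hG : CutBound G p Δ) (hp : 0 < p) {l : ℕ}
    (hl : (l : ℝ) ≤ 2 * p * Fintype.card V)
    (hdirty : Fintype.card V ≤
      ⌊Fintype.card V - l / (2 * p)⌋₊ + (φ.dirty (φ.levelTime l)).card) :
    (l : ℝ) ^ 2 / (4 * p) - p - Δ - 2 * φ.laterDeviation p ≤ φ.T := by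
  have hx0 : (0 : ℝ) ≤ Fintype.card V - l / (2 * p) := by
    rw [sub_nonneg, div_le_iff₀ (by positivity)]
    linarith
  have hlen := φ.le_T hG hp (Nat.floor_le_of_le (sub_le_self _ (by positivity))) hdirty
  have hfloor := sub_le_mul_floor_sub hp.le hx0
  set n : ℝ := (Fintype.card V : ℝ)
  set x := n - l / (2 * p) with hx
  have hl2 : (l : ℝ) = 2 * p * (n - x) := by
    rw [hx]
    field_simp
    ring
  have hsq : (l : ℝ) ^ 2 / (4 * p) = p * x ^ 2 + l * n - p * n ^ 2 := by
    rw [hl2]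
    field_simp
    ring
  have hlj : (l : ℝ) * ⌊x⌋₊ = 2 * p * (n - x) * ⌊x⌋₊ := by rw [← hl2]
  linarith

end GreedyPlay

theorem le_gameBrushNumber [Nonempty V] (hG : CutBound G p Δ) (hp : 0 < p) {m M : ℕ} (hm : 0 < m)
    (hmM : Fintype.card V ≤ M * m) {κ : ℝ} (hκ : Real.exp (-(1 / 2)) < κ) (hκ1 : κ ≤ 1)
    (hlarge : p * Fintype.card V + 2 ≤ levelCurve κ * (p * Fintype.card V))
    (herr : 4 * Δ + 4 * Fintype.card V + 4 * p * Fintype.card V + p + 1 +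
      2 * (M * (3 * Δ + 2 * p * m ^ 2)) <
        p * Fintype.card V ^ 2 * (κ - levelCurve κ / 2) ^ 2) :
    (levelCurve κ * (p * Fintype.card V) - 1) ^ 2 / (4 * p) - p - Δ -
      2 * (M * (3 * Δ + 2 * p * m ^ 2)) ≤ gameBrushNumber G := by
  inhabit V
  obtain ⟨φ, hφ⟩ := exists_fullGreedyPlay_le_gameBrushNumber (G := G)
  have hdev : φ.laterDeviation p ≤ M * (3 * Δ + 2 * p * m ^ 2) :=
    hG.sum_abs_later_le hp.le φ.pos hm hmM
  have hq : 0 ≤ p * Fintype.card V := by positivity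
  set l := ⌊levelCurve κ * (p * Fintype.card V)⌋₊
  have hl : (l : ℝ) ≤ levelCurve κ * (p * Fintype.card V) := Nat.floor_le (by linarith)
  have hl' : levelCurve κ * (p * Fintype.card V) < l + 1 := Nat.lt_floor_add_one _
  have hl2 : (l : ℝ) ≤ 2 * p * Fintype.card V := by
    have : levelCurve κ * (p * Fintype.card V) ≤ 2 * (p * Fintype.card V) := by
      gcongr
      linarith [levelCurve_lt_two_mul hκ]
    linarith
  have hdirty := φ.card_le_floor_add_card_dirty hG hp Fintype.card_pos hκ hκ1
    (Nat.ceil_le.2 (by linarith)) hl (by linarith)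
  have hsq : (levelCurve κ * (p * Fintype.card V) - 1) ^ 2 / (4 * p) ≤ (l : ℝ) ^ 2 / (4 * p) := by
    gcongr <;> linarith
  linarith [φ.sq_div_sub_le_T hG hp hl2 hdirty, (Nat.cast_le (α := ℝ)).2 hφ]

end Lower

/-! ### Random graphs -/

section RandomGraph

open MeasureTheory ProbabilityTheory unitInterval

variable {V : Type*}

instance [Countable V] : MeasurableSingletonClass (SimpleGraph V) where
  measurableSet_singleton G := by
    rw [← SimpleGraph.measurableEmbedding_edgeSet.measurableSet_image, Set.image_singleton]
    exact MeasurableSet.singleton _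

theorem exp_moment_factor_le {p θ : ℝ} (hp : 0 ≤ p) (hθ : |θ| ≤ 1 / 2) {c : ℕ} (hc : c ≤ 2) :
    p * Real.exp (θ * c) + (1 - p) ≤ Real.exp (p * (θ * c) + 4 * p * θ ^ 2) := by
  have hc2 : (c : ℝ) ≤ 2 := mod_cast hc
  have habs : |θ * c| ≤ 1 := by
    rw [abs_mul, Nat.abs_cast]
    nlinarith [abs_nonneg θ]
  have hsq : (θ * c) ^ 2 ≤ 4 * θ ^ 2 := by
    nlinarith [mul_le_mul_of_nonneg_left (pow_le_pow_left₀ (Nat.cast_nonneg c) hc2 2)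
      (sq_nonneg θ)]
  calc p * Real.exp (θ * c) + (1 - p)
      ≤ p * (1 + θ * c + (θ * c) ^ 2) + (1 - p) := by
        gcongr
        linarith [(abs_le.1 (Real.abs_exp_sub_one_sub_id_le habs)).2]
    _ ≤ p * (θ * c) + 4 * p * θ ^ 2 + 1 := by nlinarith
    _ ≤ _ := Real.add_one_le_exp _

section EdgeCount

variable [DecidableEq V]

/-- The number of ordered pairs in `S × T` whose underlying unordered pair is `e`. An edge `e`
contributes this many units to the sum of `degIn G T v` over `v ∈ S`. -/
def pairCount (S T : Finset V) (e : Sym2 V) : ℕ :=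
  {x ∈ S ×ˢ T | s(x.1, x.2) = e}.card

theorem pairCount_le_two (S T : Finset V) (e : Sym2 V) : pairCount S T e ≤ 2 := by
  induction e with
  | _ a b =>
    have hsub : {x ∈ S ×ˢ T | s(x.1, x.2) = s(a, b)} ⊆ {(a, b), (b, a)} := by
      rintro ⟨x, y⟩ hx
      simpa only [Finset.mem_insert, Finset.mem_singleton, Prod.mk.injEq, Sym2.eq_iff]
        using (Finset.mem_filter.1 hx).2
    exact (Finset.card_le_card hsub).trans Finset.card_le_two

theorem sum_degIn_top_add_card_inter (S T : Finset V) :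
    ∑ v ∈ S, degIn ⊤ T v + (S ∩ T).card = S.card * T.card := by
  have hdeg (v : V) : degIn ⊤ T v + (if v ∈ T then 1 else 0) = T.card := by
    simp only [degIn, SimpleGraph.top_adj]
    rw [Finset.filter_ne]
    split_ifs with hv
    · exact Finset.card_erase_add_one hv
    · rw [Finset.erase_eq_of_notMem hv, add_zero]
  rw [← Finset.filter_mem_eq_inter, Finset.card_filter, ← Finset.sum_add_distrib,
    Finset.sum_congr rfl fun v _ => hdeg v, Finset.sum_const, smul_eq_mul]

variable [Fintype V]

theorem binomialRandom_real_singleton (p : I) (G : SimpleGraph V) [DecidableRel G.Adj] :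
    (SimpleGraph.binomialRandom V p).real {G} =
      (p : ℝ) ^ G.edgeFinset.card *
        (1 - p : ℝ) ^ ((⊤ : SimpleGraph V).edgeFinset \ G.edgeFinset).card := by
  rw [measureReal_def, SimpleGraph.binomialRandom_singleton, Set.ncard_eq_toFinset_card',
    Finset.card_sdiff_of_subset (SimpleGraph.edgeFinset_mono le_top),
    SimpleGraph.card_edgeFinset_top_eq_card_choose_two, Nat.card_eq_fintype_card]
  simp [SimpleGraph.edgeFinset]

open Classical in
theorem sum_binomialRandom_mul_prod (p : I) (x : Sym2 V → ℝ) :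
    ∑ G : SimpleGraph V, (SimpleGraph.binomialRandom V p).real {G} * ∏ e ∈ G.edgeFinset, x e =
      ∏ e ∈ (⊤ : SimpleGraph V).edgeFinset, ((p : ℝ) * x e + (1 - p)) := by
  rw [Finset.prod_add]
  refine Finset.sum_nbij' (fun G => G.edgeFinset)
    (fun t => SimpleGraph.fromEdgeSet (t : Set (Sym2 V)))
    (fun G _ => Finset.mem_powerset.2 (SimpleGraph.edgeFinset_mono le_top))
    (fun _ _ => Finset.mem_univ _)
    (fun G _ => by rw [SimpleGraph.coe_edgeFinset, SimpleGraph.fromEdgeSet_edgeSet])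
    (fun t ht => ?_) (fun G _ => ?_)
  · ext e
    have he : e ∈ t → e ∈ (⊤ : SimpleGraph V).edgeFinset := fun h => Finset.mem_powerset.1 ht h
    simp only [SimpleGraph.mem_edgeFinset, SimpleGraph.edgeSet_top, Set.mem_compl_iff] at he
    simp only [SimpleGraph.mem_edgeFinset, SimpleGraph.edgeSet_fromEdgeSet, Set.mem_sdiff,
      Finset.mem_coe]
    tauto
  · rw [binomialRandom_real_singleton, Finset.prod_mul_distrib, Finset.prod_const,
      Finset.prod_const]
    ring

theorem sum_degIn_eq_sum_pairCount (G : SimpleGraph V) [DecidableRel G.Adj] (S T : Finset V) :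
    ∑ v ∈ S, degIn G T v = ∑ e ∈ G.edgeFinset, pairCount S T e := by
  have hpairs : ∑ v ∈ S, degIn G T v = {x ∈ S ×ˢ T | G.Adj x.1 x.2}.card := by
    simp only [degIn, Finset.card_filter, Finset.sum_product]
    congr! 3
  rw [hpairs, Finset.card_eq_sum_card_fiberwise (f := fun x : V × V => s(x.1, x.2))
    (t := G.edgeFinset)]
  · refine Finset.sum_congr rfl fun e he => ?_
    rw [pairCount, Finset.filter_filter]
    congr 1
    ext x
    simp only [Finset.mem_filter, and_congr_right_iff, and_iff_right_iff_imp]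
    rintro - rfl
    simpa using he
  · intro x hx
    simpa using (Finset.mem_filter.1 (Finset.mem_coe.1 hx)).2

theorem mgf_sum_degIn (p : I) (S T : Finset V) (θ : ℝ) :
    mgf (fun G : SimpleGraph V => ∑ v ∈ S, (degIn G T v : ℝ)) (SimpleGraph.binomialRandom V p) θ =
      ∏ e ∈ (⊤ : SimpleGraph V).edgeFinset,
        ((p : ℝ) * Real.exp (θ * pairCount S T e) + (1 - p)) := by
  classical
  rw [mgf, integral_fintype .of_finite, ← sum_binomialRandom_mul_prod]
  refine Finset.sum_congr rfl fun G _ => ?_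
  rw [smul_eq_mul, ← Real.exp_sum, ← Finset.mul_sum]
  exact_mod_cast congrArg _ (congrArg (fun k : ℕ => Real.exp (θ * k))
    (sum_degIn_eq_sum_pairCount G S T))

end EdgeCount

variable [Fintype V]

theorem mgf_sum_degIn_le (p : I) (S T : Finset V) {θ : ℝ} (hθ : |θ| ≤ 1 / 2) :
    mgf (fun G : SimpleGraph V => ∑ v ∈ S, (degIn G T v : ℝ)) (SimpleGraph.binomialRandom V p) θ ≤
      Real.exp (θ * (p * ∑ v ∈ S, (degIn ⊤ T v : ℝ)) + 4 * p * θ ^ 2 * Fintype.card V ^ 2) := by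
  classical
  have hp0 : (0 : ℝ) ≤ p := p.2.1
  have hcard : ((⊤ : SimpleGraph V).edgeFinset.card : ℝ) ≤ (Fintype.card V : ℝ) ^ 2 := by
    rw [SimpleGraph.card_edgeFinset_top_eq_card_choose_two]
    exact_mod_cast Nat.choose_le_pow _ _
  have hsum : ∑ v ∈ S, (degIn ⊤ T v : ℝ) =
      ∑ e ∈ (⊤ : SimpleGraph V).edgeFinset, (pairCount S T e : ℝ) :=
    mod_cast sum_degIn_eq_sum_pairCount ⊤ S T
  calc _ = ∏ e ∈ (⊤ : SimpleGraph V).edgeFinset,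
        ((p : ℝ) * Real.exp (θ * pairCount S T e) + (1 - p)) := mgf_sum_degIn p S T θ
    _ ≤ ∏ e ∈ (⊤ : SimpleGraph V).edgeFinset,
        Real.exp (p * (θ * pairCount S T e) + 4 * p * θ ^ 2) :=
      Finset.prod_le_prod (fun _ _ => add_nonneg (by positivity) (by linarith [p.2.2]))
        fun e _ => exp_moment_factor_le hp0 hθ (pairCount_le_two S T e)
    _ = Real.exp (θ * (p * ∑ v ∈ S, (degIn ⊤ T v : ℝ)) +
        4 * p * θ ^ 2 * (⊤ : SimpleGraph V).edgeFinset.card) := by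
      rw [← Real.exp_sum, Finset.sum_add_distrib, Finset.sum_const, nsmul_eq_mul,
        ← Finset.mul_sum, ← Finset.mul_sum, hsum]
      ring_nf
    _ ≤ _ := by gcongr

theorem binomialRandom_deviation_le (p : I) (S T : Finset V) {δ : ℝ} (hδ : 0 < δ) (hδ1 : δ ≤ 1) :
    (SimpleGraph.binomialRandom V p).real {G | δ * (p * (Fintype.card V : ℝ) ^ 2) ≤
      |∑ v ∈ S, (degIn G T v : ℝ) - p * ∑ v ∈ S, (degIn ⊤ T v : ℝ)|} ≤
      2 * Real.exp (-(δ ^ 2 * (p * (Fintype.card V : ℝ) ^ 2) / 16)) := by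
  set N : ℝ := p * (Fintype.card V : ℝ) ^ 2
  set d : ℝ := p * ∑ v ∈ S, (degIn ⊤ T v : ℝ)
  set X : SimpleGraph V → ℝ := fun G => ∑ v ∈ S, (degIn G T v : ℝ)
  set μ := SimpleGraph.binomialRandom V p
  have hθ : |δ / 8| ≤ 1 / 2 := by rw [abs_of_pos (by positivity)]; linarith
  have hupper : μ.real {G | d + δ * N ≤ X G} ≤ Real.exp (-(δ ^ 2 * N / 16)) := by
    calc _ ≤ Real.exp (-(δ / 8) * (d + δ * N)) * mgf X μ (δ / 8) :=
          measure_ge_le_exp_mul_mgf _ (by positivity) .of_finite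
      _ ≤ Real.exp (-(δ / 8) * (d + δ * N)) *
          Real.exp (δ / 8 * d + 4 * p * (δ / 8) ^ 2 * Fintype.card V ^ 2) := by
        gcongr; exact mgf_sum_degIn_le p S T hθ
      _ = _ := by rw [← Real.exp_add]; simp only [N]; ring_nf
  have hlower : μ.real {G | X G ≤ d - δ * N} ≤ Real.exp (-(δ ^ 2 * N / 16)) := by
    calc _ ≤ Real.exp (-(-(δ / 8)) * (d - δ * N)) * mgf X μ (-(δ / 8)) :=
          measure_le_le_exp_mul_mgf _ (by linarith) .of_finite
      _ ≤ Real.exp (-(-(δ / 8)) * (d - δ * N)) *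
          Real.exp (-(δ / 8) * d + 4 * p * (-(δ / 8)) ^ 2 * Fintype.card V ^ 2) := by
        gcongr; exact mgf_sum_degIn_le p S T (by rwa [abs_neg])
      _ = _ := by rw [← Real.exp_add]; simp only [N]; ring_nf
  have hsub : {G | δ * N ≤ |X G - d|} ⊆ {G | d + δ * N ≤ X G} ∪ {G | X G ≤ d - δ * N} := by
    intro G hG
    rcases le_abs.1 (show δ * N ≤ |X G - d| from hG) with h | h
    · exact .inl (by change d + δ * N ≤ X G; linarith)
    · exact .inr (by change X G ≤ d - δ * N; linarith)
  calc _ ≤ _ := measureReal_mono hsub (measure_ne_top _ _)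
    _ ≤ _ := measureReal_union_le _ _
    _ ≤ _ := by linarith

theorem cutBound_of_forall_deviation_lt {G : SimpleGraph V} {p Δ : ℝ} (hp : 0 ≤ p)
    (h : ∀ S T : Finset V,
      |∑ v ∈ S, (degIn G T v : ℝ) - p * ∑ v ∈ S, (degIn ⊤ T v : ℝ)| < Δ) :
    CutBound G p (Δ + p * Fintype.card V) := by
  classical
  intro S T
  have hcard : (S.card : ℝ) * T.card = ∑ v ∈ S, (degIn ⊤ T v : ℝ) + (S ∩ T).card :=
    mod_cast (sum_degIn_top_add_card_inter S T).symm
  calc |∑ v ∈ S, (degIn G T v : ℝ) - p * S.card * T.card|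
      = |(∑ v ∈ S, (degIn G T v : ℝ) - p * ∑ v ∈ S, (degIn ⊤ T v : ℝ)) - p * (S ∩ T).card| := by
        rw [mul_assoc, hcard]; ring_nf
    _ ≤ |∑ v ∈ S, (degIn G T v : ℝ) - p * ∑ v ∈ S, (degIn ⊤ T v : ℝ)| + |p * (S ∩ T).card| :=
        abs_sub _ _
    _ ≤ Δ + p * Fintype.card V := by
        rw [abs_of_nonneg (by positivity : 0 ≤ p * ((S ∩ T).card : ℝ))]
        gcongr
        · exact (h S T).le
        · exact Finset.card_le_univ _

theorem binomialRandom_not_cutBound_le (p : I) {δ : ℝ} (hδ : 0 < δ) (hδ1 : δ ≤ 1) :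
    (SimpleGraph.binomialRandom V p).real {G | ¬ CutBound G p
      (δ * (p * (Fintype.card V : ℝ) ^ 2) + p * Fintype.card V)} ≤
      2 * 4 ^ Fintype.card V * Real.exp (-(δ ^ 2 * (p * (Fintype.card V : ℝ) ^ 2) / 16)) := by
  set N : ℝ := p * (Fintype.card V : ℝ) ^ 2
  let bad (S T : Finset V) : Set (SimpleGraph V) :=
    {G | δ * N ≤ |∑ v ∈ S, (degIn G T v : ℝ) - p * ∑ v ∈ S, (degIn ⊤ T v : ℝ)|}
  have hsub : {G | ¬ CutBound G p (δ * N + p * Fintype.card V)} ⊆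
      ⋃ x ∈ (Finset.univ : Finset (Finset V × Finset V)), bad x.1 x.2 := by
    intro G hG
    by_contra hgood
    simp only [bad, Finset.mem_univ, Set.iUnion_true, Set.mem_iUnion, Set.mem_ofPred_eq,
      not_exists, not_le] at hgood
    exact hG (cutBound_of_forall_deviation_lt p.2.1 fun S T => hgood (S, T))
  calc _ ≤ _ := measureReal_mono hsub (measure_ne_top _ _)
    _ ≤ ∑ x : Finset V × Finset V, (SimpleGraph.binomialRandom V p).real (bad x.1 x.2) :=
        measureReal_biUnion_finset_le _ _
    _ ≤ ∑ _x : Finset V × Finset V, 2 * Real.exp (-(δ ^ 2 * N / 16)) :=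
        Finset.sum_le_sum fun x _ => binomialRandom_deviation_le p x.1 x.2 hδ hδ1
    _ = _ := by
        rw [Finset.sum_const, Finset.card_univ, Fintype.card_prod, Fintype.card_finset,
          nsmul_eq_mul, ← mul_pow]
        push_cast
        ring

end RandomGraph

section DenseGraphs

theorem exists_levelCurve_near {ε : ℝ} (hε : 0 < ε) :
    ∃ κ, Real.exp (-(1 / 2)) < κ ∧ κ < 1 ∧ Real.exp (-1) - ε < levelCurve κ ^ 2 / 4 := by
  have hvalue : levelCurve (Real.exp (-(1 / 2))) ^ 2 / 4 = Real.exp (-1) := by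
    have hsq : Real.exp (-1) = Real.exp (-(1 / 2)) * Real.exp (-(1 / 2)) := by
      rw [← Real.exp_add]; norm_num
    rw [levelCurve, Real.log_exp, hsq]
    ring
  have hcont : ContinuousAt (fun κ => levelCurve κ ^ 2 / 4) (Real.exp (-(1 / 2))) :=
    ((hasDerivAt_levelCurve (Real.exp_pos _)).continuousAt.pow 2).div_const 4
  have hnear := (hcont.eventually_const_lt (by rw [hvalue]; linarith :
    Real.exp (-1) - ε < levelCurve (Real.exp (-(1 / 2))) ^ 2 / 4)).filter_mono
      (nhdsWithin_le_nhds (s := Set.Ioi (Real.exp (-(1 / 2)))))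
  obtain ⟨κ, hκ, hlt, hlt1⟩ :=
    (hnear.and (Ioo_mem_nhdsGT (Real.exp_lt_one_iff.2 (by norm_num : -(1 / 2 : ℝ) < 0)))).exists
  exact ⟨κ, hlt, hlt1, hκ⟩

theorem mul_mul_div_sq_le {p n η M : ℝ} (hp : 0 ≤ p) (hM : 0 < M) (hηM : 128 ≤ η * M) :
    M * (p * (n / M) ^ 2) ≤ η * (p * n ^ 2) / 128 := by
  have hpn : 0 ≤ p * n ^ 2 := by positivity
  calc M * (p * (n / M) ^ 2) = p * n ^ 2 / M := by field_simp
    _ ≤ η * (p * n ^ 2) / 128 := by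
      rw [div_le_iff₀ hM]
      nlinarith

theorem sq_sub_mul_floor_le {n M : ℝ} (hM : 1 ≤ M) (hMn : M ≤ n / M) :
    (n - (M - 1) * ⌊n / M⌋₊) ^ 2 ≤ (2 * (n / M)) ^ 2 := by
  have hqM : M * (n / M) = n := by field_simp
  have hfloor : (⌊n / M⌋₊ : ℝ) ≤ n / M := Nat.floor_le (by linarith)
  have hfloor' := Nat.lt_floor_add_one (n / M)
  exact pow_le_pow_left₀ (by nlinarith) (by nlinarith) 2

variable {V : Type*} [Fintype V] [DecidableEq V] {G : SimpleGraph V} {p η : ℝ} {M : ℕ}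

theorem gameBrushNumber_le_of_cutBound (hp : 0 < p) (hp1 : p ≤ 1) (hη : 0 < η) (hM : 0 < M)
    (hηM : 128 ≤ η * M) (hdense : 2 * (M : ℝ) ^ 2 ≤ p * Fintype.card V)
    (hG : CutBound G p (η / (80 * M) * (p * (Fintype.card V : ℝ) ^ 2))) :
    (gameBrushNumber G : ℝ) ≤ p * (Fintype.card V : ℝ) ^ 2 * Real.exp (-1) +
      η * (p * (Fintype.card V : ℝ) ^ 2) := by
  set n : ℝ := (Fintype.card V : ℝ)
  set Δ : ℝ := η / (80 * M) * (p * n ^ 2) with hΔ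
  have hM1 : (1 : ℝ) ≤ M := mod_cast hM
  have hM0 : (0 : ℝ) < M := by linarith
  have hn0 : 0 ≤ n := Nat.cast_nonneg _
  have hblocks := mul_mul_div_sq_le (n := n) hp.le hM0 hηM
  have hMΔ : M * Δ = η * (p * n ^ 2) / 80 := by rw [hΔ]; field_simp
  have hM_le : M ≤ n / M := by
    rw [le_div_iff₀ hM0]
    nlinarith [mul_le_of_le_one_left hn0 hp1]
  set m := ⌊n / M⌋₊
  have hm_le : (m : ℝ) ≤ n / M := Nat.floor_le (by positivity)
  have hm : 0 < m := Nat.floor_pos.2 (hM1.trans hM_le)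
  have hcard : M * m ≤ Fintype.card V := by
    have : (M * m : ℝ) ≤ Fintype.card V := by rwa [← le_div_iff₀' hM0]
    exact_mod_cast this
  have hremainder : 2 * p * (n - (M - 1) * m) ^ 2 ≤ 8 * (M * (p * (n / M) ^ 2)) := by
    calc 2 * p * (n - (M - 1) * m) ^ 2 ≤ 2 * p * (2 * (n / M)) ^ 2 := by
          gcongr 2 * p * ?_
          exact sq_sub_mul_floor_le hM1 hM_le
      _ = 8 * (1 * (p * (n / M) ^ 2)) := by ring
      _ ≤ 8 * (M * (p * (n / M) ^ 2)) := by gcongr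
  have hsteps : (M : ℝ) * (26 * p * m ^ 2) ≤ 26 * (M * (p * (n / M) ^ 2)) := by
    calc (M : ℝ) * (26 * p * m ^ 2) ≤ M * (26 * p * (n / M) ^ 2) := by gcongr
      _ = _ := by ring
  have hrounding : 2 * (M : ℝ) ≤ M * (p * (n / M) ^ 2) := by
    have hpq : 2 * (M : ℝ) ≤ p * (n / M) := by
      rw [← mul_div_assoc, le_div_iff₀ hM0]
      linarith
    calc 2 * (M : ℝ) ≤ p * (n / M) * 1 := by rwa [mul_one]
      _ ≤ p * (n / M) * (M * (n / M)) := by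
        gcongr
        nlinarith
      _ = _ := by ring
  have hΔ_le : Δ ≤ M * Δ := le_mul_of_one_le_left hG.nonneg hM1
  have hmain := gameBrushNumber_le hG hp hm hM hcard
  have hN : 0 ≤ η * (p * n ^ 2) := by positivity
  linarith

theorem le_gameBrushNumber_of_cutBound {κ : ℝ} (hκ : Real.exp (-(1 / 2)) < κ) (hκ1 : κ ≤ 1)
    (hp : 0 < p) (hp1 : p ≤ 1) (hη : 0 < η) (hηκ : η ≤ (κ - levelCurve κ / 2) ^ 2) (hM : 0 < M)
    (hηM : 128 ≤ η * M) (hdense : 2 * (M : ℝ) ^ 2 ≤ p * Fintype.card V)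
    (hdense_η : 80 ≤ η * (p * Fintype.card V))
    (hlarge : p * Fintype.card V + 2 ≤ levelCurve κ * (p * Fintype.card V))
    (hG : CutBound G p (η / (80 * M) * (p * (Fintype.card V : ℝ) ^ 2))) :
    levelCurve κ ^ 2 / 4 * (p * (Fintype.card V : ℝ) ^ 2) -
      η / 2 * (p * (Fintype.card V : ℝ) ^ 2) ≤ gameBrushNumber G := by
  set n : ℝ := (Fintype.card V : ℝ)
  set N : ℝ := p * n ^ 2 with hN
  set Δ : ℝ := η / (80 * M) * N with hΔ
  have hM1 : (1 : ℝ) ≤ M := mod_cast hM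
  have hM0 : (0 : ℝ) < M := by linarith
  have hpn : p * n ≤ n := mul_le_of_le_one_left (Nat.cast_nonneg _) hp1
  have hM_le : M ≤ n / M := by
    rw [le_div_iff₀ hM0]
    nlinarith
  have hn1 : 1 ≤ n := by nlinarith
  have : Nonempty V := Fintype.card_pos_iff.1 (Nat.cast_pos.1 (by linarith : (0 : ℝ) < n))
  have hηN : 0 < η * N := by positivity
  have hblocks := mul_mul_div_sq_le (n := n) hp.le hM0 hηM
  have hMΔ : M * Δ = η * N / 80 := by rw [hΔ]; field_simp
  have hΔ_le : Δ ≤ M * Δ := le_mul_of_one_le_left hG.nonneg hM1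
  have hlinear : 80 * n ≤ η * N := by
    calc 80 * n ≤ η * (p * n) * n := by gcongr
      _ = η * N := by rw [hN]; ring
  set m := ⌊n / M⌋₊ + 1 with hm
  have hcard : Fintype.card V ≤ M * m := by
    have : (Fintype.card V : ℝ) ≤ M * m := by
      rw [← div_le_iff₀' hM0, hm]
      exact_mod_cast (Nat.lt_floor_add_one (n / M)).le
    exact_mod_cast this
  have hsteps : (M : ℝ) * (3 * Δ + 2 * p * m ^ 2) ≤ η * N / 8 := by
    have hm_le : (m : ℝ) ≤ 2 * (n / M) := by
      rw [hm, Nat.cast_add_one]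
      linarith [Nat.floor_le (by positivity : 0 ≤ n / M)]
    calc (M : ℝ) * (3 * Δ + 2 * p * m ^ 2) ≤ M * (3 * Δ + 2 * p * (2 * (n / M)) ^ 2) := by gcongr
      _ = 3 * (M * Δ) + 8 * (M * (p * (n / M) ^ 2)) := by ring
      _ ≤ η * N / 8 := by linarith
  have hgap : η * N ≤ N * (κ - levelCurve κ / 2) ^ 2 := by rw [mul_comm N]; gcongr
  have hmain := le_gameBrushNumber hG hp (Nat.succ_pos _) hcard hκ hκ1 hlarge (by linarith)
  have hlevel : levelCurve κ * n ≤ 2 * n := by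
    gcongr
    linarith [levelCurve_lt_two_mul hκ]
  have hsquare : (levelCurve κ * (p * n) - 1) ^ 2 / (4 * p) =
      levelCurve κ ^ 2 / 4 * N - levelCurve κ * n / 2 + 1 / (4 * p) := by
    rw [hN]; field_simp; ring
  have hpos : 0 ≤ 1 / (4 * p) := by positivity
  linarith

end DenseGraphs

section Asymptotics

open Filter Topology MeasureTheory unitInterval

theorem exists_gameBrushNumber_near {ε : ℝ} (hε : 0 < ε) :
    ∃ δ > 0, ∃ K : ℝ, ∀ {V : Type*} [Fintype V] [DecidableEq V] (G : SimpleGraph V) (p : ℝ),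
      0 < p → p ≤ 1 → K ≤ p * Fintype.card V →
      CutBound G p (δ * (p * (Fintype.card V : ℝ) ^ 2)) →
      |(gameBrushNumber G : ℝ) - p * (Fintype.card V : ℝ) ^ 2 / Real.exp 1| ≤
        ε * (p * (Fintype.card V : ℝ) ^ 2 / Real.exp 1) := by
  set ε' := ε * Real.exp (-1) with hε'
  obtain ⟨κ, hκ, hκ1, hlevel⟩ := exists_levelCurve_near (by positivity : 0 < ε' / 2)
  have hl : 1 < levelCurve κ := by
    rw [← levelCurve_one]
    exact strictAntiOn_levelCurve hκ ⟨le_rfl, hκ1.le⟩ ⟨hκ1.le, le_rfl⟩ hκ1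
  have hgap : 0 < κ - levelCurve κ / 2 := by linarith [levelCurve_lt_two_mul hκ]
  obtain ⟨η, hη, hηmin⟩ := exists_between (by positivity :
    0 < min ((κ - levelCurve κ / 2) ^ 2) ε')
  obtain ⟨hηκ, hηε⟩ := lt_min_iff.1 hηmin
  obtain ⟨M, hM⟩ := exists_nat_gt (128 / η)
  have hM0 : (0 : ℝ) < M := (by positivity : (0 : ℝ) < 128 / η).trans hM
  refine ⟨η / (80 * M), by positivity,
    max (80 / η) (max (2 / (levelCurve κ - 1)) (2 * M ^ 2)), ?_⟩
  intro V _ _ G p hp hp1 hK hG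
  obtain ⟨hK_η, hK_level, hK_M⟩ : _ ∧ _ ∧ _ := by simpa only [max_le_iff] using hK
  rw [div_le_iff₀' hη] at hK_η
  rw [div_le_iff₀ (by linarith)] at hK_level
  have hηM : 128 ≤ η * M := ((div_lt_iff₀' hη).1 hM).le
  have hupper := gameBrushNumber_le_of_cutBound hp hp1 hη (Nat.cast_pos.1 hM0) hηM hK_M hG
  have hlower := le_gameBrushNumber_of_cutBound hκ hκ1.le hp hp1 hη hηκ.le (Nat.cast_pos.1 hM0)
    hηM hK_M hK_η (by linarith) hG
  rw [div_eq_mul_inv, ← Real.exp_neg, abs_le]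
  set N := p * (Fintype.card V : ℝ) ^ 2
  have hηN : η * N ≤ ε' * N := by gcongr
  have hlevelN : (Real.exp (-1) - ε' / 2) * N ≤ levelCurve κ ^ 2 / 4 * N := by gcongr
  have hε'N : ε' * N = ε * (N * Real.exp (-1)) := by rw [hε']; ring
  constructor <;> linarith

theorem isEquivalent_gameBrushNumber_top :
    Asymptotics.IsEquivalent atTop
      (fun n : ℕ => (gameBrushNumber (⊤ : SimpleGraph (Fin n)) : ℝ))
      (fun n : ℕ => (n : ℝ) ^ 2 / Real.exp 1) := by
  refine Asymptotics.isLittleO_iff.2 fun ε hε => ?_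
  obtain ⟨δ, hδ, K, hnear⟩ := exists_gameBrushNumber_near hε
  filter_upwards [tendsto_natCast_atTop_atTop.eventually_ge_atTop K,
    tendsto_natCast_atTop_atTop.eventually_ge_atTop (1 / δ)] with n hK hδn
  have hcut : CutBound (⊤ : SimpleGraph (Fin n)) 1 (δ * (1 * (Fintype.card (Fin n) : ℝ) ^ 2)) := by
    refine cutBound_top.mono ?_
    rw [Fintype.card_fin, one_mul]
    rw [div_le_iff₀' hδ] at hδn
    nlinarith
  have hn := hnear (⊤ : SimpleGraph (Fin n)) 1 one_pos le_rfl (by simpa using hK) hcut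
  rw [Fintype.card_fin, one_mul] at hn
  rwa [Pi.sub_apply, Real.norm_eq_abs, Real.norm_of_nonneg (by positivity)]

theorem tendsto_measureReal_one_mono {ι : Type*} {l : Filter ι} {Ω : ι → Type*}
    [∀ i, MeasurableSpace (Ω i)] {μ : ∀ i, Measure (Ω i)} [∀ i, IsProbabilityMeasure (μ i)]
    {A B : ∀ i, Set (Ω i)} (hA : Tendsto (fun i => (μ i).real (A i)) l (𝓝 1))
    (hAB : ∀ᶠ i in l, A i ⊆ B i) : Tendsto (fun i => (μ i).real (B i)) l (𝓝 1) :=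
  tendsto_of_tendsto_of_tendsto_of_le_of_le' hA tendsto_const_nhds
    (hAB.mono fun _ h => measureReal_mono h) (Eventually.of_forall fun _ => measureReal_le_one)

theorem four_pow_mul_exp_le {n : ℕ} {x : ℝ} (hx : Real.log 4 + 1 ≤ x) :
    4 ^ n * Real.exp (-(x * n)) ≤ Real.exp (-n) := by
  have hpow : (4 : ℝ) ^ n = Real.exp (n * Real.log 4) := by
    rw [mul_comm, Real.exp_mul, Real.exp_log (by norm_num), Real.rpow_natCast]
  rw [hpow, ← Real.exp_add, Real.exp_le_exp]
  nlinarith [(Nat.cast_nonneg n : (0 : ℝ) ≤ n)]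

theorem tendsto_binomialRandom_cutBound {p : ℕ → I}
    (hp : Tendsto (fun n : ℕ => (p n : ℝ) * n) atTop atTop) {δ : ℝ} (hδ : 0 < δ) :
    Tendsto (fun n : ℕ => (SimpleGraph.binomialRandom (Fin n) (p n)).real
      {G | CutBound G (p n) (δ * (p n * n ^ 2))}) atTop (𝓝 1) := by
  set δ' := min (δ / 2) 1
  have hδ'0 : 0 < δ' := by positivity
  have hlim : Tendsto (fun n : ℕ => 1 - 2 * Real.exp (-(n : ℝ))) atTop (𝓝 1) := by
    simpa using ((Real.tendsto_exp_neg_atTop_nhds_zero.comp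
      tendsto_natCast_atTop_atTop).const_mul 2).const_sub 1
  refine tendsto_of_tendsto_of_tendsto_of_le_of_le' hlim tendsto_const_nhds ?_
    (Eventually.of_forall fun n => measureReal_le_one)
  filter_upwards [hp.eventually_ge_atTop ((Real.log 4 + 1) * 16 / δ' ^ 2),
    tendsto_natCast_atTop_atTop.eventually_ge_atTop (2 / δ)] with n hdense hn
  have herr : δ' * (p n * (n : ℝ) ^ 2) + p n * n ≤ δ * (p n * n ^ 2) := by
    have hp0 : (0 : ℝ) ≤ p n := (p n).2.1
    have hmain : δ' * (p n * (n : ℝ) ^ 2) ≤ δ / 2 * (p n * n ^ 2) := by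
      gcongr
      exact min_le_left _ _
    have hdiag : (p n : ℝ) * n * 2 ≤ p n * n * (δ * n) := by
      gcongr
      exact (div_le_iff₀' hδ).1 hn
    linarith
  have hbad := binomialRandom_not_cutBound_le (V := Fin n) (p n) hδ'0 (min_le_right _ _)
  have hexp := four_pow_mul_exp_le (n := n) (x := δ' ^ 2 * (p n * n) / 16) (by
    rw [div_le_iff₀' (by positivity)] at hdense
    linarith)
  rw [Fintype.card_fin, mul_assoc,
    show δ' ^ 2 * (p n * (n : ℝ) ^ 2) / 16 = δ' ^ 2 * (p n * n) / 16 * n by ring] at hbad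
  calc 1 - 2 * Real.exp (-(n : ℝ))
      ≤ 1 - (SimpleGraph.binomialRandom (Fin n) (p n)).real
          {G | ¬ CutBound G (p n) (δ' * (p n * (n : ℝ) ^ 2) + p n * n)} := by linarith
    _ = (SimpleGraph.binomialRandom (Fin n) (p n)).real
          {G | CutBound G (p n) (δ' * (p n * (n : ℝ) ^ 2) + p n * n)} := by
        rw [← probReal_compl_eq_one_sub (Set.toFinite _).measurableSet]
        simp [Set.compl_ofPred]
    _ ≤ _ := measureReal_mono fun G hG => CutBound.mono hG herr

theorem tendsto_gameBrushNumber_near {p : ℕ → I}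
    (hp : Tendsto (fun n : ℕ => (p n : ℝ) * n) atTop atTop) {ε : ℝ} (hε : 0 < ε) :
    Tendsto (fun n : ℕ => (SimpleGraph.binomialRandom (Fin n) (p n)).real
      {G | |(gameBrushNumber G : ℝ) - p n * n ^ 2 / Real.exp 1| ≤
        ε * (p n * n ^ 2 / Real.exp 1)}) atTop (𝓝 1) := by
  obtain ⟨δ, hδ, K, hnear⟩ := exists_gameBrushNumber_near hε
  refine tendsto_measureReal_one_mono (tendsto_binomialRandom_cutBound hp hδ) ?_
  filter_upwards [hp.eventually_ge_atTop K, hp.eventually_gt_atTop 0] with n hK hpn G hG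
  have hp0 : (0 : ℝ) < p n := pos_of_mul_pos_left hpn (Nat.cast_nonneg n)
  simpa using hnear G (p n) hp0 (p n).2.2 (by simpa using hK) (by simpa using hG)

theorem abs_sub_le_mul_of_near {a b x δ ε : ℝ} (hx : 0 ≤ x) (hδ : δ ≤ 1 / 2) (hδε : δ ≤ ε / 4)
    (hε : 0 ≤ ε) (ha : |a - x| ≤ δ * x) (hb : |b - x| ≤ δ * x) : |a - b| ≤ ε * b := by
  have hb_ge : x / 2 ≤ b := by nlinarith [(abs_le.1 hb).1]
  calc |a - b| ≤ |a - x| + |x - b| := abs_sub_le _ _ _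
    _ ≤ δ * x + δ * x := by rw [abs_sub_comm x]; gcongr
    _ ≤ ε * (x / 2) := by nlinarith
    _ ≤ ε * b := by gcongr

theorem tendsto_mul_of_isLittleO {p : ℕ → I}
    (hp : Asymptotics.IsLittleO atTop (fun n : ℕ => Real.log n / n) (fun n : ℕ => (p n : ℝ))) :
    Tendsto (fun n : ℕ => (p n : ℝ) * n) atTop atTop := by
  refine tendsto_atTop_mono' _ ?_ (Real.tendsto_log_atTop.comp tendsto_natCast_atTop_atTop)
  filter_upwards [hp.def one_pos, eventually_gt_atTop 0] with n hn hn0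
  rw [one_mul, Real.norm_of_nonneg (p n).2.1] at hn
  exact (div_le_iff₀ (Nat.cast_pos.2 hn0)).1 ((le_abs_self _).trans hn)

end Asymptotics

end Brushing

theorem mainTheorem1_general (p : ℕ → unitInterval)
    (hp : Filter.Tendsto (fun n : ℕ => (p n : ℝ) * n) Filter.atTop Filter.atTop) :
    (∀ ε : ℝ, 0 < ε →
      Filter.Tendsto (fun n : ℕ => (SimpleGraph.binomialRandom (Fin n) (p n)).real
        {G : SimpleGraph (Fin n) |
          |(Brushing.gameBrushNumber G : ℝ) -
              p n * Brushing.gameBrushNumber (⊤ : SimpleGraph (Fin n))| ≤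
            ε * (p n * Brushing.gameBrushNumber (⊤ : SimpleGraph (Fin n)))})
        Filter.atTop (nhds 1)) ∧
    Asymptotics.IsEquivalent Filter.atTop
      (fun n : ℕ => (p n : ℝ) * Brushing.gameBrushNumber (⊤ : SimpleGraph (Fin n)))
      (fun n : ℕ => (p n : ℝ) * n ^ 2 / Real.exp 1) ∧
    (∀ ε : ℝ, 0 < ε →
      Filter.Tendsto (fun n : ℕ => (SimpleGraph.binomialRandom (Fin n) (p n)).real
        {G : SimpleGraph (Fin n) |
          |(Brushing.gameBrushNumber G : ℝ) - p n * n ^ 2 / Real.exp 1| ≤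
            ε * (p n * n ^ 2 / Real.exp 1)})
        Filter.atTop (nhds 1)) := by
  have htop : Asymptotics.IsEquivalent Filter.atTop
      (fun n : ℕ => (p n : ℝ) * Brushing.gameBrushNumber (⊤ : SimpleGraph (Fin n)))
      (fun n : ℕ => (p n : ℝ) * n ^ 2 / Real.exp 1) := by
    simp only [mul_div_assoc]
    exact Asymptotics.IsEquivalent.refl.mul Brushing.isEquivalent_gameBrushNumber_top
  refine ⟨fun ε hε => ?_, htop, fun ε hε => Brushing.tendsto_gameBrushNumber_near hp hε⟩
  have hδ : 0 < min (1 / 2) (ε / 4) := by positivity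
  refine Brushing.tendsto_measureReal_one_mono (Brushing.tendsto_gameBrushNumber_near hp hδ) ?_
  filter_upwards [htop.isLittleO.def hδ] with n hn G hG
  have hx : 0 ≤ (p n : ℝ) * n ^ 2 / Real.exp 1 :=
    div_nonneg (mul_nonneg (p n).2.1 (sq_nonneg _)) (Real.exp_pos 1).le
  rw [Pi.sub_apply, Real.norm_eq_abs, Real.norm_of_nonneg hx] at hn
  exact Brushing.abs_sub_le_mul_of_near hx (min_le_left _ _) (min_le_right _ _) hε.le hG hn

theorem mainTheorem1 (p : ℕ → unitInterval)
    (hp : Asymptotics.IsLittleO Filter.atTop (fun n : ℕ => Real.log n / n)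
      (fun n : ℕ => (p n : ℝ))) :
    (∀ ε : ℝ, 0 < ε →
      Filter.Tendsto (fun n : ℕ => (SimpleGraph.binomialRandom (Fin n) (p n)).real
        {G : SimpleGraph (Fin n) |
          |(Brushing.gameBrushNumber G : ℝ) -
              p n * Brushing.gameBrushNumber (⊤ : SimpleGraph (Fin n))| ≤
            ε * (p n * Brushing.gameBrushNumber (⊤ : SimpleGraph (Fin n)))})
        Filter.atTop (nhds 1)) ∧
    Asymptotics.IsEquivalent Filter.atTop
      (fun n : ℕ => (p n : ℝ) * Brushing.gameBrushNumber (⊤ : SimpleGraph (Fin n)))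
      (fun n : ℕ => (p n : ℝ) * n ^ 2 / Real.exp 1) ∧
    (∀ ε : ℝ, 0 < ε →
      Filter.Tendsto (fun n : ℕ => (SimpleGraph.binomialRandom (Fin n) (p n)).real
        {G : SimpleGraph (Fin n) |
          |(Brushing.gameBrushNumber G : ℝ) - p n * n ^ 2 / Real.exp 1| ≤
            ε * (p n * n ^ 2 / Real.exp 1)})
        Filter.atTop (nhds 1)) :=
  mainTheorem1_general p (Brushing.tendsto_mul_of_isLittleO hp)
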